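/- Let $k$ be a field and let $B=\bigoplus_{n\ge 0}B_n$ be a connected graded $k$-algebra, i.e. an associative unital $\mathbb{N}$-graded $k$-algebra with $B_0=k$. Let $z\in B_1$ be an element that is regular (neither a left nor a right zero divisor) and normal ($zB=Bz$). If $B$ has global dimension $d<\infty$, then the factor ring $B/(z)$ has global dimension $d-1$ (in particular $d\ge 1$). Here the global dimension of a ring is the supremum of the projective dimensions of its modules; the statement holds both for left modules (the left global dimension of $B$ being $d$ implies that the one of $B/(z)$ is $d-1$) and for right modules. -/

import Mathlib

universe u

/-- The left global dimension of a ring `R`: the supremum of the projective dimensions of all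
left `R`-modules. -/
noncomputable def leftGlobalDimension (R : Type u) [Ring R] : WithBot ℕ∞ :=
  ⨆ M : ModuleCat.{u} R, CategoryTheory.projectiveDimension M

/-- The right global dimension of a ring `R`: the supremum of the projective dimensions of all
right `R`-modules, that is, of all left modules over the opposite ring. -/
noncomputable def rightGlobalDimension (R : Type u) [Ring R] : WithBot ℕ∞ :=
  leftGlobalDimension Rᵐᵒᵖ

/-- An `ℕ`-graded `k`-algebra `B = ⨁ B_n` is connected if `B_0 = k`: the structure map `k → B`
is injective and its image is the degree zero part. -/
structure IsConnectedGraded {k B : Type*} [Field k] [Ring B] [Algebra k B]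
    (𝒜 : ℕ → Submodule k B) [GradedAlgebra 𝒜] : Prop where
  algebraMap_injective : Function.Injective (algebraMap k B)
  mem_zero_iff : ∀ b : B, b ∈ 𝒜 0 ↔ ∃ c : k, algebraMap k B c = b

/-- An element `z` of a ring `B` is normal if `zB = Bz`. -/
def IsNormalElement {B : Type*} [Ring B] (z : B) : Prop :=
  Set.range (fun b : B => z * b) = Set.range (fun b : B => b * z)

/-- The quotient ring `B/(z)` of `B` by the two-sided ideal generated by `z`. -/
abbrev QuotientByElement {B : Type*} [Ring B] (z : B) : Type _ :=
  B ⧸ (TwoSidedIdeal.span {z}).asIdeal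

/-! Write A = B/(z), and let R_+ be the augmentation ideal of a connected graded algebra R.

Only modules killed by R_+ matter for the global dimension of R. An arbitrary, possibly ungraded,
module M carries the filtration equal to M in all degrees ≥ 0 and to 0 below, and its associated
graded module is M with R acting through R_0. Projective dimension does not exceed that of the
associated graded module (`AssociatedGraded.pdLE`): a strict free cover has a kernel whose
associated graded module is the kernel of the induced cover, so one descends through syzygies to the
case where gr M is projective. Then graded Nakayama gives gr M a homogeneous basis
(`ModuleGrading.exists_homogeneous_basis`), which lifts to a basis of M.

Lower bound for A: each free A-module has a free resolution of length one over B, so restriction to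
B raises projective dimension by at most one (`pdLE_restrictScalars`). Modules killed by B_+ are
A-modules, hence gldim B ≤ gldim A + 1.

Upper bound: let T be an A-module killed by B_+, and cover it over B by a free module F on a k-basis
of T, with kernel X = B_+F. Since z is regular on X, pd_A(X/zX) ≤ pd_B X ≤ d - 1
(`pdLE_of_surjective`). Moreover T is a direct summand of X/zX, embedded as Fz/Xz and split off by a
functional on B_1 taking the value 1 at z (`IsRegularNormalQuotient.pdLE_of_trivial`). This is where
z having degree one is essential.

The case d = 0 is impossible because B/B_+ is killed by z and so cannot embed in B. The right-handed
statement follows by passing to opposite rings. -/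

open CategoryTheory in
/-- The `R`-module `M` has projective dimension at most `n`. -/
abbrev PdLE (R : Type u) [Ring R] (M : Type u) [AddCommGroup M] [Module R M] (n : ℕ) : Prop :=
  HasProjectiveDimensionLE (ModuleCat.of R M) n

/-! ### Bounds on projective dimension -/

namespace PdLE

open CategoryTheory

section

variable {R : Type u} [Ring R] {M N P : Type u} [AddCommGroup M] [Module R M]
  [AddCommGroup N] [Module R N] [AddCommGroup P] [Module R P]

theorem zero_iff : PdLE R M 0 ↔ Module.Projective R M := by
  rw [PdLE, ← projective_iff_hasProjectiveDimensionLE_zero, IsProjective.iff_projective]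

theorem mono {m n : ℕ} (h : PdLE R M m) (hmn : m ≤ n) : PdLE R M n :=
  haveI : HasProjectiveDimensionLT (ModuleCat.of R M) (m + 1) := h
  hasProjectiveDimensionLT_of_ge _ (m + 1) (n + 1) (by omega)

theorem of_projective [Module.Projective R M] (n : ℕ) : PdLE R M n :=
  (zero_iff.2 ‹_›).mono (Nat.zero_le n)

theorem of_leftInverse {n : ℕ} (i : M →ₗ[R] N) (r : N →ₗ[R] M) (h : ∀ x, r (i x) = x)
    (hN : PdLE R N n) : PdLE R M n :=
  haveI : HasProjectiveDimensionLT (ModuleCat.of R N) (n + 1) := hN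
  Retract.hasProjectiveDimensionLT (X := ModuleCat.of R M) (Y := ModuleCat.of R N)
    ⟨ModuleCat.ofHom i, ModuleCat.ofHom r, by ext x; exact h x⟩ (n + 1)

theorem of_equiv {n : ℕ} (e : M ≃ₗ[R] N) (hN : PdLE R N n) : PdLE R M n :=
  hN.of_leftInverse e.toLinearMap e.symm.toLinearMap (by simp)

/-- The sequence `ker f → P → M`. -/
abbrev kerComplex (f : P →ₗ[R] M) : ShortComplex (ModuleCat.{u} R) :=
  ShortComplex.mk (ModuleCat.ofHom f.ker.subtype) (ModuleCat.ofHom f) (by ext x; exact x.2)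

theorem shortExact_kerComplex (f : P →ₗ[R] M) (hf : Function.Surjective f) :
    (kerComplex f).ShortExact where
  exact := by
    rw [ShortComplex.moduleCat_exact_iff]
    intro x hx
    exact ⟨⟨x, hx⟩, rfl⟩
  mono_f := (ModuleCat.mono_iff_injective _).2 Subtype.val_injective
  epi_g := (ModuleCat.epi_iff_surjective _).2 hf

theorem succ_iff [Module.Projective R P] (f : P →ₗ[R] M) (hf : Function.Surjective f) (n : ℕ) :
    PdLE R M (n + 1) ↔ PdLE R f.ker n :=
  (shortExact_kerComplex f hf).hasProjectiveDimensionLT_X₃_iff n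
    (ModuleCat.projective_of_categoryTheory_projective (ModuleCat.of R P))

end

end PdLE

/-! ### Global dimension -/

theorem leftGlobalDimension_le_iff (R : Type u) [Ring R] (n : ℕ) :
    leftGlobalDimension R ≤ n ↔
      ∀ (M : Type u) [AddCommGroup M] [Module R M], PdLE R M n := by
  simp only [leftGlobalDimension, iSup_le_iff, CategoryTheory.projectiveDimension_le_iff]
  exact ⟨fun h M _ _ => h (ModuleCat.of R M), fun h M => h M⟩

/-- Needed to turn a finite upper bound on the global dimension of a nonzero ring into a natural
number value. -/
theorem leftGlobalDimension_ne_bot (R : Type u) [Ring R] [Nontrivial R] :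
    leftGlobalDimension R ≠ ⊥ := by
  intro h
  have h' : CategoryTheory.projectiveDimension (ModuleCat.of R R) ≤ ⊥ :=
    h ▸ le_iSup (fun M : ModuleCat.{u} R => CategoryTheory.projectiveDimension M) _
  rw [le_bot_iff, CategoryTheory.projectiveDimension_eq_bot_iff,
    ModuleCat.isZero_iff_subsingleton] at h'
  exact not_subsingleton R h'

/-! ### Graded modules and graded free modules -/

section Grading

variable {k R : Type*} [Field k] [Ring R] [Algebra k R]

/-- A grading of the `R`-module `N` over the graded algebra `R = ⨁ 𝒜 n`, given by the projections
onto the homogeneous components. -/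
structure ModuleGrading (𝒜 : ℕ → Submodule k R) (N : Type*) [AddCommGroup N] [Module R N] where
  /-- The projection onto a homogeneous component. -/
  comp : ℕ → N →+ N
  comp_comp : ∀ i j x, comp i (comp j x) = if i = j then comp j x else 0
  bound : ∀ x, ∃ m, ∀ i, m < i → comp i x = 0
  eq_zero : ∀ x, (∀ i, comp i x = 0) → x = 0
  comp_smul : ∀ i j a x, a ∈ 𝒜 i → comp (i + j) (a • x) = a • comp j x
  comp_smul_lt : ∀ i j a x, a ∈ 𝒜 i → j < i → comp j (a • x) = 0

namespace ModuleGrading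

variable {𝒜 : ℕ → Submodule k R} {N : Type*} [AddCommGroup N] [Module R N]

theorem comp_self (G : ModuleGrading 𝒜 N) (i : ℕ) (x : N) : G.comp i (G.comp i x) = G.comp i x := by
  rw [G.comp_comp, if_pos rfl]

theorem comp_ne (G : ModuleGrading 𝒜 N) {i j : ℕ} (h : i ≠ j) (x : N) :
    G.comp i (G.comp j x) = 0 := by
  rw [G.comp_comp, if_neg h]

theorem comp_eq_zero_of_homogeneous (G : ModuleGrading 𝒜 N) {i j : ℕ} (h : i ≠ j) {x : N}
    (hx : G.comp j x = x) : G.comp i x = 0 := by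
  rw [← hx, G.comp_ne h]

theorem eq_sum (G : ModuleGrading 𝒜 N) {m : ℕ} {x : N} (h : ∀ i, m < i → G.comp i x = 0) :
    x = ∑ i ∈ Finset.range (m + 1), G.comp i x := by
  rw [← sub_eq_zero]
  refine G.eq_zero _ fun i => ?_
  simp only [map_sub, map_sum, G.comp_comp, Finset.sum_ite_eq, Finset.mem_range]
  split_ifs with hi
  · exact sub_self _
  · rw [h i (by omega), sub_zero]

/-- The grading induced on a graded submodule. -/
def restrict (G : ModuleGrading 𝒜 N) (W : Submodule R N) (hW : ∀ i, ∀ x ∈ W, G.comp i x ∈ W) :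
    ModuleGrading 𝒜 W where
  comp i := ((G.comp i).comp W.subtype.toAddMonoidHom).codRestrict W fun x => hW i x x.2
  comp_comp i j x := by
    ext
    change G.comp i (G.comp j x) = _
    rw [G.comp_comp]
    split_ifs <;> rfl
  bound x := (G.bound x).imp fun m h i hi => Subtype.ext (h i hi)
  eq_zero x h := Subtype.ext (G.eq_zero x fun i => congrArg Subtype.val (h i))
  comp_smul i j a x ha := Subtype.ext (G.comp_smul i j a x ha)
  comp_smul_lt i j a x ha h := Subtype.ext (G.comp_smul_lt i j a x ha h)

@[simp]
theorem coe_restrict_comp (G : ModuleGrading 𝒜 N) (W : Submodule R N)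
    (hW : ∀ i, ∀ x ∈ W, G.comp i x ∈ W) (i : ℕ) (x : W) :
    (((G.restrict W hW).comp i x : W) : N) = G.comp i x := rfl

variable [GradedAlgebra 𝒜]

variable (𝒜) in
/-- The graded `R`-module `R` with generator placed in degree `d`. -/
def shift (d : ℕ) : ModuleGrading 𝒜 R where
  comp m := if d ≤ m then GradedRing.proj 𝒜 (m - d) else 0
  comp_comp i j x := by
    by_cases hi : d ≤ i <;> by_cases hj : d ≤ j
    · simp only [hi, hj, if_true, GradedRing.proj_apply, DirectSum.decompose_coe,
        DirectSum.coe_of_apply]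
      by_cases h : i = j
      · simp [h]
      · rw [if_neg (by omega), if_neg h]; rfl
    · simp only [hi, hj, if_true, if_false, AddMonoidHom.zero_apply, map_zero, ite_self]
    · simp only [hi, hj, if_true, if_false, AddMonoidHom.zero_apply]
      rw [if_neg (by omega)]
    · simp [hi, hj]
  bound x := by
    classical
    refine ⟨(DirectSum.decompose 𝒜 x).support.sup id + d, fun i hi => ?_⟩
    rw [if_pos (by omega), GradedRing.proj_apply]
    by_contra h
    have : i - d ∈ (DirectSum.decompose 𝒜 x).support := by
      rw [DFinsupp.mem_support_iff]
      intro h'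
      exact h (by rw [h']; rfl)
    have := Finset.le_sup (f := id) this
    simp only [id] at this
    omega
  eq_zero x h := by
    classical
    rw [← DirectSum.sum_support_decompose 𝒜 x]
    refine Finset.sum_eq_zero fun i _ => ?_
    have := h (i + d)
    rwa [if_pos (by omega), Nat.add_sub_cancel] at this
  comp_smul i j a x ha := by
    by_cases hj : d ≤ j
    · rw [if_pos (by omega), if_pos hj, show i + j - d = i + (j - d) by omega]
      exact DirectSum.coe_decompose_mul_add_of_left_mem 𝒜 ha
    · rw [if_neg hj]
      by_cases hij : d ≤ i + j
      · rw [if_pos hij, AddMonoidHom.zero_apply, smul_zero]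
        exact DirectSum.coe_decompose_mul_of_left_mem_of_not_le 𝒜 ha (by omega)
      · rw [if_neg hij, AddMonoidHom.zero_apply, AddMonoidHom.zero_apply, smul_zero]
  comp_smul_lt i j a x ha h := by
    by_cases hj : d ≤ j
    · rw [if_pos hj]
      exact DirectSum.coe_decompose_mul_of_left_mem_of_not_le 𝒜 ha (by omega)
    · rw [if_neg hj, AddMonoidHom.zero_apply]

theorem shift_comp_mem (d m : ℕ) (b : R) : (shift 𝒜 d).comp m b ∈ 𝒜 (m - d) := by
  change (if d ≤ m then GradedRing.proj 𝒜 (m - d) else 0) b ∈ _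
  split_ifs
  · exact SetLike.coe_mem _
  · exact zero_mem _

theorem shift_comp_of_lt {d m : ℕ} (h : m < d) (b : R) : (shift 𝒜 d).comp m b = 0 := by
  change (if d ≤ m then GradedRing.proj 𝒜 (m - d) else 0) b = _
  rw [if_neg (by omega)]; rfl

theorem shift_comp_of_mem {d j : ℕ} {b : R} (hb : b ∈ 𝒜 j) (m : ℕ) :
    (shift 𝒜 d).comp m b = if m = j + d then b else 0 := by
  change (if d ≤ m then GradedRing.proj 𝒜 (m - d) else 0) b = _
  split_ifs with h h' h'
  · exact DirectSum.decompose_of_mem_same 𝒜 (by rwa [show m - d = j by omega])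
  · exact DirectSum.decompose_of_mem_ne 𝒜 hb (by omega)
  · omega
  · rfl

variable (𝒜) in
/-- The free graded `R`-module whose basis elements have the degrees `d`. -/
noncomputable def free {ι : Type*} (d : ι → ℕ) : ModuleGrading 𝒜 (ι →₀ R) where
  comp m :=
    { toFun := fun p => Finsupp.onFinset p.support (fun i => (shift 𝒜 (d i)).comp m (p i))
        fun i hi => by
          rw [Finsupp.mem_support_iff]
          intro h
          exact hi (by rw [h, map_zero])
      map_zero' := by ext i; simp
      map_add' := fun p q => by ext i; simp }
  comp_comp i j p := by
    ext l
    by_cases h : i = j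
    · simpa [h] using (shift 𝒜 (d l)).comp_self j (p l)
    · simpa [h] using (shift 𝒜 (d l)).comp_ne h (p l)
  bound p := by
    classical
    choose B hB using fun i => (shift 𝒜 (d i)).bound (p i)
    refine ⟨p.support.sup B, fun i hi => ?_⟩
    ext l
    by_cases hl : l ∈ p.support
    · exact hB l i (lt_of_le_of_lt (Finset.le_sup hl) hi)
    · rw [Finsupp.notMem_support_iff] at hl
      simp [hl]
  eq_zero p h := by
    ext l
    exact (shift 𝒜 (d l)).eq_zero _ fun i => DFunLike.congr_fun (h i) l
  comp_smul i j a p ha := by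
    ext l
    exact (shift 𝒜 (d l)).comp_smul i j a (p l) ha
  comp_smul_lt i j a p ha h := by
    ext l
    exact (shift 𝒜 (d l)).comp_smul_lt i j a (p l) ha h

theorem free_comp_apply {ι : Type*} (d : ι → ℕ) (m : ℕ) (p : ι →₀ R) (i : ι) :
    (free 𝒜 d).comp m p i = (shift 𝒜 (d i)).comp m (p i) := rfl

theorem free_comp_single {ι : Type*} (d : ι → ℕ) (m : ℕ) (i : ι) (b : R) :
    (free 𝒜 d).comp m (Finsupp.single i b) = Finsupp.single i ((shift 𝒜 (d i)).comp m b) := by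
  classical
  ext j
  rw [free_comp_apply, Finsupp.single_apply, Finsupp.single_apply]
  split_ifs with h
  · rw [h]
  · rw [map_zero]

theorem comp_smul_homogeneous (G : ModuleGrading 𝒜 N) {d : ℕ} {v : N} (hv : G.comp d v = v)
    (m : ℕ) (b : R) : G.comp m (b • v) = (shift 𝒜 d).comp m b • v := by
  induction b using DirectSum.Decomposition.inductionOn 𝒜 with
  | zero => simp
  | @homogeneous j b =>
    have h := G.comp_smul j d b v b.2
    rw [hv] at h
    rw [shift_comp_of_mem b.2]
    split_ifs with hm
    · rw [hm, h]
    · rw [G.comp_eq_zero_of_homogeneous hm h, zero_smul]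
  | add a b ha hb => rw [add_smul, map_add, ha, hb, map_add, add_smul]

theorem comp_linearCombination (G : ModuleGrading 𝒜 N) {ι : Type*} {d : ι → ℕ} {v : ι → N}
    (hv : ∀ i, G.comp (d i) (v i) = v i) (m : ℕ) (p : ι →₀ R) :
    G.comp m (Finsupp.linearCombination R v p) =
      Finsupp.linearCombination R v ((free 𝒜 d).comp m p) := by
  induction p using Finsupp.induction_linear with
  | zero => simp
  | add p q hp hq => simp only [map_add, hp, hq]
  | single i b =>
    rw [free_comp_single, Finsupp.linearCombination_single, Finsupp.linearCombination_single,
      G.comp_smul_homogeneous (hv i)]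

end ModuleGrading

end Grading

/-! ### Graded Nakayama lemma and graded projectives -/

section Nakayama

variable {k R : Type*} [Field k] [Ring R] [Algebra k R] (𝒜 : ℕ → Submodule k R) [GradedAlgebra 𝒜]

/-- The augmentation ideal `⨁_{n > 0} 𝒜 n`, as a left ideal. -/
def augmentationIdeal : Ideal R := RingHom.ker (GradedRing.projZeroRingHom 𝒜)

variable {𝒜}

theorem mem_augmentationIdeal {b : R} :
    b ∈ augmentationIdeal 𝒜 ↔ (DirectSum.decompose 𝒜 b 0 : R) = 0 := Iff.rfl

theorem mem_augmentationIdeal_of_mem {i : ℕ} (hi : 0 < i) {b : R} (hb : b ∈ 𝒜 i) :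
    b ∈ augmentationIdeal 𝒜 :=
  DirectSum.decompose_of_mem_ne 𝒜 hb hi.ne'

theorem sub_projZero_mem_augmentationIdeal (b : R) :
    b - GradedRing.projZeroRingHom 𝒜 b ∈ augmentationIdeal 𝒜 := by
  change GradedRing.projZeroRingHom 𝒜 (b - _) = 0
  rw [map_sub, sub_eq_zero]
  exact (DirectSum.decompose_of_mem_same 𝒜 (SetLike.coe_mem _)).symm

namespace IsConnectedGraded

theorem exists_algebraMap_sub_mem (hR : IsConnectedGraded 𝒜) (b : R) :
    ∃ c : k, b - algebraMap k R c ∈ augmentationIdeal 𝒜 := by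
  obtain ⟨c, hc⟩ := (hR.mem_zero_iff (GradedRing.projZeroRingHom 𝒜 b)).1 (SetLike.coe_mem _)
  exact ⟨c, hc ▸ sub_projZero_mem_augmentationIdeal b⟩

theorem eq_zero_of_algebraMap_mem (hR : IsConnectedGraded 𝒜)
    {c : k} (h : algebraMap k R c ∈ augmentationIdeal 𝒜) :
    c = 0 := by
  have h' : (DirectSum.decompose 𝒜 (algebraMap k R c) 0 : R) = algebraMap k R c :=
    DirectSum.decompose_of_mem_same 𝒜 ((hR.mem_zero_iff _).2 ⟨c, rfl⟩)
  rw [mem_augmentationIdeal, h'] at h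
  exact hR.algebraMap_injective (by rw [h, map_zero])

end IsConnectedGraded

variable {N : Type*} [AddCommGroup N] [Module R N]

/-- The graded Nakayama lemma. -/
theorem ModuleGrading.eq_top_of_augmentation (G : ModuleGrading 𝒜 N) (W : Submodule R N)
    (hW : ∀ i, ∀ x ∈ W, G.comp i x ∈ W)
    (h : W ⊔ augmentationIdeal 𝒜 • (⊤ : Submodule R N) = ⊤) : W = ⊤ := by
  classical
  have key : ∀ m x, G.comp m x ∈ W := by
    intro m
    induction m using Nat.strong_induction_on with
    | _ m ih =>
      intro x
      obtain ⟨w, hw, y, hy, rfl⟩ := Submodule.mem_sup.1 (h ▸ Submodule.mem_top : x ∈ _)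
      rw [map_add]
      refine add_mem (hW m w hw) ?_
      refine Submodule.smul_induction_on hy (fun a ha n _ => ?_) fun a b ha hb => ?_
      · rw [← DirectSum.sum_support_decompose 𝒜 a, Finset.sum_smul, map_sum]
        refine sum_mem fun i _ => ?_
        obtain rfl | hi := Nat.eq_zero_or_pos i
        · rw [mem_augmentationIdeal.1 ha, zero_smul, map_zero]
          exact zero_mem _
        · obtain hm | hm := lt_or_ge m i
          · rw [G.comp_smul_lt i m _ n (SetLike.coe_mem _) hm]
            exact zero_mem _
          · obtain ⟨j, rfl⟩ := Nat.exists_eq_add_of_le hm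
            rw [G.comp_smul i j _ n (SetLike.coe_mem _)]
            exact W.smul_mem _ (ih j (by omega) n)
      · rw [map_add]
        exact add_mem ha hb
  refine eq_top_iff.2 fun x _ => ?_
  obtain ⟨m, hm⟩ := G.bound x
  rw [G.eq_sum hm]
  exact sum_mem fun i _ => key i x

theorem Finsupp.mem_smul_top_of_forall_mem {ι : Type*} (I : Ideal R) (p : ι →₀ R)
    (hp : ∀ i, p i ∈ I) : p ∈ I • (⊤ : Submodule R (ι →₀ R)) := by
  classical
  rw [← Finsupp.sum_single p]
  refine sum_mem fun i _ => ?_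
  rw [← mul_one (p i), ← smul_eq_mul, ← Finsupp.smul_single]
  exact Submodule.smul_mem_smul (hp i) trivial

/-- A graded projective module over a connected graded algebra has a homogeneous basis. -/
theorem ModuleGrading.exists_homogeneous_basis (hR : IsConnectedGraded 𝒜)
    {N : Type u} [AddCommGroup N] [Module R N]
    (G : ModuleGrading 𝒜 N) [Module.Projective R N] :
    ∃ (ι : Type u) (d : ι → ℕ) (v : ι → N), (∀ i, G.comp (d i) (v i) = v i) ∧
      Function.Bijective (Finsupp.linearCombination R v) := by
  classical
  let M : Submodule R N := augmentationIdeal 𝒜 • ⊤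
  let _ : Module k (N ⧸ M) := Module.compHom _ (algebraMap k R)
  have smul_def : ∀ (c : k) (x : N ⧸ M), c • x = algebraMap k R c • x := fun _ _ => rfl
  have aug_smul : ∀ b ∈ augmentationIdeal 𝒜, ∀ x : N ⧸ M, b • x = 0 := by
    intro b hb x
    obtain ⟨y, rfl⟩ := M.mkQ_surjective x
    rw [← map_smul]
    exact (Submodule.Quotient.mk_eq_zero M).2 (Submodule.smul_mem_smul hb trivial)
  -- Classes of homogeneous elements span `N ⧸ M` over `k`, so a basis can be chosen among them; its
  -- homogeneous lifts will form the basis of `N`.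
  obtain ⟨s, hs, hspan, hli⟩ := exists_linearIndependent k
    {x : N ⧸ M | ∃ d, ∃ v, G.comp d v = v ∧ M.mkQ v = x}
  choose! d v hv hvx using fun x (hx : x ∈ s) => hs hx
  have hspan' : Submodule.span k s = ⊤ := by
    rw [hspan, eq_top_iff]
    intro x _
    obtain ⟨y, rfl⟩ := M.mkQ_surjective x
    obtain ⟨m, hm⟩ := G.bound y
    rw [G.eq_sum hm, map_sum]
    exact sum_mem fun i _ => Submodule.subset_span ⟨i, _, G.comp_self i y, rfl⟩
  let ψ : (s →₀ R) →ₗ[R] N := Finsupp.linearCombination R fun x : s => v x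
  have hG : ∀ m p, G.comp m (ψ p) = ψ ((free 𝒜 fun x : s => d x).comp m p) :=
    G.comp_linearCombination fun x : s => hv x x.2
  have hsurj : Function.Surjective ψ := by
    rw [← LinearMap.range_eq_top]
    refine G.eq_top_of_augmentation _ ?_ ?_
    · rintro m _ ⟨p, rfl⟩
      exact ⟨_, (hG m p).symm⟩
    · rw [eq_top_iff]
      intro x _
      have hx : M.mkQ x ∈ Submodule.span k s := hspan' ▸ Submodule.mem_top
      have : ∃ w ∈ ψ.range, M.mkQ w = M.mkQ x := by
        generalize M.mkQ x = y at hx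
        induction hx using Submodule.span_induction with
        | mem x hx =>
          refine ⟨v x, ⟨Finsupp.single ⟨x, hx⟩ 1, ?_⟩, hvx x hx⟩
          simp [ψ]
        | zero => exact ⟨0, zero_mem _, map_zero _⟩
        | add x y _ _ hx hy =>
          obtain ⟨a, ha, rfl⟩ := hx
          obtain ⟨b, hb, rfl⟩ := hy
          exact ⟨a + b, add_mem ha hb, map_add _ _ _⟩
        | smul c x _ hx =>
          obtain ⟨a, ha, rfl⟩ := hx
          exact ⟨algebraMap k R c • a, Submodule.smul_mem _ _ ha, map_smul _ _ _⟩
      obtain ⟨w, hw, hwx⟩ := this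
      refine Submodule.mem_sup.2 ⟨w, hw, x - w, ?_, by abel⟩
      rw [← Submodule.Quotient.mk_eq_zero M]
      change M.mkQ (x - w) = 0
      rw [map_sub, hwx, sub_self]
  -- Modulo the augmentation ideal a relation becomes a `k`-linear relation between independent
  -- vectors.
  have hker : ∀ p, ψ p = 0 → ∀ x, p x ∈ augmentationIdeal 𝒜 := by
    intro p hp
    choose c hc using fun b => hR.exists_algebraMap_sub_mem (𝒜 := 𝒜) b
    have h0 : ∑ x ∈ p.support, c (p x) • (x : N ⧸ M) = 0 := by
      have h1 : M.mkQ (ψ p) = 0 := by rw [hp, map_zero]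
      rw [Finsupp.linearCombination_apply, Finsupp.sum, map_sum] at h1
      rw [← h1]
      refine Finset.sum_congr rfl fun x _ => ?_
      rw [map_smul, hvx x x.2, smul_def, eq_comm, ← sub_eq_zero, ← sub_smul]
      exact aug_smul _ (hc _) _
    have h2 := linearIndependent_iff'.1 hli p.support (fun x => c (p x)) h0
    intro x
    by_cases hx : x ∈ p.support
    · have := hc (p x)
      rwa [h2 x hx, map_zero, sub_zero] at this
    · rw [Finsupp.notMem_support_iff.1 hx]
      exact zero_mem _
  have hinj : Function.Injective ψ := by
    rw [← LinearMap.ker_eq_bot]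
    let L := ψ.ker
    have hL : ∀ i, ∀ x ∈ L, (free 𝒜 fun x : s => d x).comp i x ∈ L := by
      intro i x hx
      rw [LinearMap.mem_ker] at hx ⊢
      rw [← hG, hx, map_zero]
    -- Projectivity makes the kernel `L` a retract of the free module. Elements of `L` have
    -- coefficients in the augmentation ideal, so applying the retraction `ρ` shows that this ideal
    -- times `L` is `L`, and Nakayama gives `L = 0`.
    obtain ⟨σ, hσ⟩ := Module.projective_lifting_property ψ LinearMap.id hsurj
    have hσ' : ∀ x, ψ (σ x) = x := fun x => LinearMap.congr_fun hσ x
    let ρ : (s →₀ R) →ₗ[R] L := (LinearMap.id - σ ∘ₗ ψ).codRestrict L fun p => by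
      change ψ (p - σ (ψ p)) = 0
      rw [map_sub, hσ', sub_self]
    have hbot : (⊥ : Submodule R L) = ⊤ := by
      refine ((free 𝒜 fun x : s => d x).restrict L hL).eq_top_of_augmentation ⊥ ?_ ?_
      · intro i x hx
        rw [Submodule.mem_bot] at hx
        rw [hx, map_zero]
        exact zero_mem _
      · rw [bot_sup_eq, eq_top_iff]
        intro p _
        have hp : ρ p = p := by
          ext1
          change (p : s →₀ R) - σ (ψ p) = p
          rw [LinearMap.mem_ker.1 p.2, map_zero, sub_zero]
        rw [← hp]
        have h1 := Submodule.mem_map_of_mem (f := ρ)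
          (Finsupp.mem_smul_top_of_forall_mem (augmentationIdeal 𝒜) p (hker p p.2))
        rw [Submodule.map_smul''] at h1
        exact Submodule.smul_mono le_rfl le_top h1
    rw [eq_bot_iff]
    intro p hp
    have : (⟨p, hp⟩ : L) ∈ (⊥ : Submodule R L) := hbot ▸ Submodule.mem_top
    exact congrArg Subtype.val ((Submodule.mem_bot _).1 this)
  exact ⟨s, fun x => d x, fun x => v x, fun x => hv x x.2, hinj, hsurj⟩

end Nakayama

/-! ### Filtered modules and their associated graded modules -/

section Filtered

variable {k R : Type*} [Field k] [Ring R] [Algebra k R] (𝒜 : ℕ → Submodule k R)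

/-- A presentation of the graded module `N` as the associated graded module of a filtered module
`K`: the pairs `(x, n)` in `symbols j` are the elements `x` of the `j`-th step of the filtration
together with their symbols `n`. -/
structure AssociatedGraded (K N : Type*) [AddCommGroup K] [Module R K] [AddCommGroup N]
    [Module R N] where
  /-- The grading of the associated graded module. -/
  grading : ModuleGrading 𝒜 N
  /-- The graphs of the symbol maps. -/
  symbols : ℕ → AddSubgroup (K × N)
  homogeneous : ∀ j x n, (x, n) ∈ symbols j → grading.comp j n = n
  symbol_zero : ∀ j n, ((0 : K), n) ∈ symbols j → n = 0
  exists_lift : ∀ j n, grading.comp j n = n → ∃ x, (x, n) ∈ symbols j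
  -- A vanishing symbol means lying in the preceding step of the filtration; the step before degree
  -- zero is zero.
  eq_zero : ∀ x, (x, (0 : N)) ∈ symbols 0 → x = 0
  mem_succ_iff : ∀ j x, (x, (0 : N)) ∈ symbols (j + 1) ↔ ∃ n, (x, n) ∈ symbols j
  smul_mem : ∀ i j a x n, a ∈ 𝒜 i → (x, n) ∈ symbols j → (a • x, a • n) ∈ symbols (i + j)
  exhaustive : ∀ x, ∃ j n, (x, n) ∈ symbols j

namespace AssociatedGraded

variable {𝒜}

section

variable {K N : Type*} [AddCommGroup K] [Module R K] [AddCommGroup N] [Module R N]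
  (S : AssociatedGraded 𝒜 K N)

theorem mem_of_lt {i j : ℕ} (h : i < j) {x : K} {n : N} (hx : (x, n) ∈ S.symbols i) :
    (x, (0 : N)) ∈ S.symbols j := by
  induction j, h using Nat.le_induction with
  | base => exact (S.mem_succ_iff i x).2 ⟨n, hx⟩
  | succ j _ ih => exact (S.mem_succ_iff j x).2 ⟨0, ih⟩

variable [GradedAlgebra 𝒜] {ι : Type*} {d : ι → ℕ} {x : ι → K} {v : ι → N}

open ModuleGrading Finsupp

theorem linearCombination_mem_of_homogeneous (h : ∀ i, (x i, v i) ∈ S.symbols (d i)) {m : ℕ}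
    {p : ι →₀ R} (hp : (free 𝒜 d).comp m p = p) :
    (linearCombination R x p, linearCombination R v p) ∈ S.symbols m := by
  have key : (linearCombination R x p, linearCombination R v p) =
      ∑ i ∈ p.support, (p i • x i, p i • v i) := by
    rw [linearCombination_apply, linearCombination_apply, Finsupp.sum, Finsupp.sum,
      Prod.ext_iff, Prod.fst_sum, Prod.snd_sum]
    exact ⟨rfl, rfl⟩
  rw [key]
  refine sum_mem fun i _ => ?_
  rw [← hp, free_comp_apply]
  obtain hm | hm := lt_or_ge m (d i)
  · rw [shift_comp_of_lt hm, zero_smul, zero_smul]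
    exact zero_mem _
  · have := S.smul_mem (m - d i) (d i) _ _ _ (shift_comp_mem (d i) m (p i)) (h i)
    rwa [Nat.sub_add_cancel hm] at this

/-- Components of `p` of degree below `m` contribute only to lower steps, where the degree `m`
symbol vanishes; the top component alone determines the symbol. -/
theorem linearCombination_mem (h : ∀ i, (x i, v i) ∈ S.symbols (d i)) {m : ℕ}
    {p : ι →₀ R} (hp : ∀ i, m < i → (free 𝒜 d).comp i p = 0) :
    (linearCombination R x p, linearCombination R v ((free 𝒜 d).comp m p)) ∈ S.symbols m := by
  have h1 := (free 𝒜 d).eq_sum hp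
  rw [Finset.sum_range_succ] at h1
  have h2 : (linearCombination R x p, linearCombination R v ((free 𝒜 d).comp m p)) =
      ∑ i ∈ Finset.range m, (linearCombination R x ((free 𝒜 d).comp i p), (0 : N)) +
        (linearCombination R x ((free 𝒜 d).comp m p),
          linearCombination R v ((free 𝒜 d).comp m p)) := by
    rw [Prod.ext_iff, Prod.fst_add, Prod.snd_add, Prod.fst_sum, Prod.snd_sum]
    refine ⟨?_, by simp⟩
    conv_lhs => rw [h1]
    simp only [map_add, map_sum]
  rw [h2]
  refine add_mem (sum_mem fun i hi => ?_)
    (S.linearCombination_mem_of_homogeneous h ((free 𝒜 d).comp_self m p))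
  exact S.mem_of_lt (Finset.mem_range.1 hi)
    (S.linearCombination_mem_of_homogeneous h ((free 𝒜 d).comp_self i p))

/-- The top component of a relation is a relation between symbols, hence zero; descending through
the degrees kills every component. -/
theorem injective_linearCombination (h : ∀ i, (x i, v i) ∈ S.symbols (d i))
    (hv : Function.Injective (linearCombination R v)) :
    Function.Injective (linearCombination R x) := by
  rw [injective_iff_map_eq_zero]
  intro p hp
  obtain ⟨m, hm⟩ := (free 𝒜 d).bound p
  have step : ∀ m, (∀ i, m < i → (free 𝒜 d).comp i p = 0) → (free 𝒜 d).comp m p = 0 := by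
    intro m hm
    have h1 := S.linearCombination_mem h hm
    rw [hp] at h1
    exact hv (by rw [S.symbol_zero _ _ h1, map_zero])
  refine (free 𝒜 d).eq_zero p fun i => ?_
  have all : ∀ m, (∀ i, m < i → (free 𝒜 d).comp i p = 0) → ∀ i, (free 𝒜 d).comp i p = 0 := by
    intro m
    induction m with
    | zero =>
      intro hm i
      obtain rfl | hi := Nat.eq_zero_or_pos i
      · exact step 0 hm
      · exact hm i hi
    | succ m ih =>
      intro hm
      refine ih fun i hi => ?_
      obtain rfl | hi := eq_or_lt_of_le (Nat.succ_le_of_lt hi)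
      · exact step _ hm
      · exact hm i hi
  exact all m hm i

/-- Matching the symbol of an element moves the error one step down, and the filtration stops below
degree zero. -/
theorem surjective_linearCombination (h : ∀ i, (x i, v i) ∈ S.symbols (d i))
    (hv : Function.Surjective (linearCombination R v)) :
    Function.Surjective (linearCombination R x) := by
  have hvd : ∀ i, S.grading.comp (d i) (v i) = v i := fun i => S.homogeneous _ _ _ (h i)
  have approx : ∀ m y n, (y, n) ∈ S.symbols m →
      ∃ p, (y - linearCombination R x p, (0 : N)) ∈ S.symbols m := by
    intro m y n hy
    obtain ⟨q, rfl⟩ := hv n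
    -- The preimage `q` need not be homogeneous, but its degree `m` component still maps to `n`,
    -- which is homogeneous of degree `m`.
    have h1 := S.linearCombination_mem_of_homogeneous h ((free 𝒜 d).comp_self m q)
    rw [← S.grading.comp_linearCombination hvd, S.homogeneous _ _ _ hy] at h1
    have h2 := sub_mem hy h1
    rw [Prod.mk_sub_mk, sub_self] at h2
    exact ⟨_, h2⟩
  have all : ∀ m y n, (y, n) ∈ S.symbols m → y ∈ (linearCombination R x).range := by
    intro m
    induction m with
    | zero =>
      intro y n hy
      obtain ⟨p, hp⟩ := approx 0 y n hy
      exact ⟨p, (sub_eq_zero.1 (S.eq_zero _ hp)).symm⟩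
    | succ m ih =>
      intro y n hy
      obtain ⟨p, hp⟩ := approx _ y n hy
      obtain ⟨n', hn'⟩ := (S.mem_succ_iff _ _).1 hp
      rw [← sub_add_cancel y (linearCombination R x p)]
      exact add_mem (ih _ _ hn') ⟨p, rfl⟩
  intro y
  obtain ⟨m, n, hy⟩ := S.exhaustive y
  exact all m y n hy

end

open ModuleGrading Finsupp

theorem projective [GradedAlgebra 𝒜] (hR : IsConnectedGraded 𝒜) {K N : Type u}
    [AddCommGroup K] [Module R K]
    [AddCommGroup N] [Module R N] (S : AssociatedGraded 𝒜 K N) [Module.Projective R N] :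
    Module.Projective R K := by
  obtain ⟨ι, d, v, hv, hinj, hsurj⟩ := S.grading.exists_homogeneous_basis hR
  choose x hx using fun i => S.exists_lift (d i) (v i) (hv i)
  exact Module.Projective.of_equiv (LinearEquiv.ofBijective (linearCombination R x)
    ⟨S.injective_linearCombination hx hinj, S.surjective_linearCombination hx hsurj⟩)

/-! ### Strict free covers and syzygies -/

section Syzygy

variable {K N : Type*} [AddCommGroup K] [Module R K] [AddCommGroup N] [Module R N]
  (S : AssociatedGraded 𝒜 K N)

/-- All triples of a degree, an element in that step of the filtration, and its symbol. -/
abbrev Generator : Type _ := {t : ℕ × K × N // t.2 ∈ S.symbols t.1}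

namespace Generator

variable {S}

/-- The degree of a generator. -/
abbrev deg (t : S.Generator) : ℕ := t.1.1

/-- The element of the filtered module underlying a generator. -/
abbrev elem (t : S.Generator) : K := t.1.2.1

/-- The symbol of a generator. -/
abbrev symbol (t : S.Generator) : N := t.1.2.2

theorem mem (t : S.Generator) : (t.elem, t.symbol) ∈ S.symbols t.deg := t.2

end Generator

open Generator

/-- The strict free presentation of the filtered module by all its elements. -/
noncomputable abbrev cover : (S.Generator →₀ R) →ₗ[R] K := linearCombination R elem

/-- The free presentation of the associated graded module induced by `cover`. -/
noncomputable abbrev coverSymbol : (S.Generator →₀ R) →ₗ[R] N := linearCombination R symbol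

theorem cover_surjective : Function.Surjective S.cover := by
  intro x
  obtain ⟨j, n, h⟩ := S.exhaustive x
  exact ⟨single ⟨(j, x, n), h⟩ 1, by simp⟩

theorem coverSymbol_surjective : Function.Surjective S.coverSymbol := by
  rw [← LinearMap.range_eq_top, eq_top_iff]
  intro n _
  obtain ⟨m, hm⟩ := S.grading.bound n
  rw [S.grading.eq_sum hm]
  refine sum_mem fun j _ => ?_
  obtain ⟨x, hx⟩ := S.exists_lift j _ (S.grading.comp_self j n)
  exact ⟨single ⟨(j, x, _), hx⟩ 1, by simp⟩

variable [GradedAlgebra 𝒜]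

theorem comp_coverSymbol (m : ℕ) (p : S.Generator →₀ R) :
    S.grading.comp m (S.coverSymbol p) = S.coverSymbol ((free 𝒜 deg).comp m p) :=
  S.grading.comp_linearCombination (fun t => S.homogeneous _ _ _ t.mem) m p

theorem comp_mem_ker_coverSymbol (m : ℕ) (p : S.Generator →₀ R) (hp : p ∈ S.coverSymbol.ker) :
    (free 𝒜 deg).comp m p ∈ S.coverSymbol.ker := by
  rw [LinearMap.mem_ker] at hp ⊢
  rw [← comp_coverSymbol, hp, map_zero]

theorem comp_mem_ker_of_mem_ker_cover {m : ℕ} {p : S.Generator →₀ R} (hp : p ∈ S.cover.ker)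
    (hm : ∀ i, m < i → (free 𝒜 deg).comp i p = 0) :
    (free 𝒜 deg).comp m p ∈ S.coverSymbol.ker := by
  have h := S.linearCombination_mem (fun t => t.mem) hm
  rw [LinearMap.mem_ker.1 hp] at h
  exact S.symbol_zero _ _ h

/-- The kernel of the free presentation of the associated graded module is the associated graded
module of the kernel of a strict free presentation. -/
noncomputable def syzygy : AssociatedGraded 𝒜 S.cover.ker S.coverSymbol.ker where
  grading := (free 𝒜 deg).restrict _ S.comp_mem_ker_coverSymbol
  symbols m :=
    { carrier := {y | (∀ i, m < i → (free 𝒜 deg).comp i (y.1 : S.Generator →₀ R) = 0) ∧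
        (y.2 : S.Generator →₀ R) = (free 𝒜 deg).comp m y.1}
      zero_mem' := by simp
      add_mem' := by
        rintro y w ⟨h1, h2⟩ ⟨h3, h4⟩
        refine ⟨fun i hi => ?_, ?_⟩
        · simp [h1 i hi, h3 i hi]
        · simp [h2, h4]
      neg_mem' := by
        rintro y ⟨h1, h2⟩
        refine ⟨fun i hi => ?_, ?_⟩
        · simp [h1 i hi]
        · simp [h2] }
  homogeneous := by
    rintro m p q ⟨_, h2⟩
    ext1
    rw [coe_restrict_comp]
    dsimp only at h2
    rw [h2, (free 𝒜 deg).comp_self]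
  symbol_zero := by
    rintro m q ⟨_, h2⟩
    ext1
    simpa using h2
  exists_lift := by
    intro m q hq
    have hq' : (free 𝒜 deg).comp m (q : S.Generator →₀ R) = q := congrArg Subtype.val hq
    have hlt : ∀ i, m < i → (free 𝒜 deg).comp i (q : S.Generator →₀ R) = 0 := fun i hi =>
      (free 𝒜 deg).comp_eq_zero_of_homogeneous (by omega) hq'
    have hmem := S.linearCombination_mem_of_homogeneous (fun t => t.mem) hq'
    have h0 : linearCombination R symbol (q : S.Generator →₀ R) = 0 := q.2
    rw [h0] at hmem
    -- The image of `q` under `cover` has zero symbol, so it lies in the preceding step. In degree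
    -- zero it vanishes; otherwise one generator of the lower degree cancels it without changing the
    -- top component `q`.
    obtain _ | m := m
    · exact ⟨⟨q, S.eq_zero _ hmem⟩, hlt, hq'.symm⟩
    · obtain ⟨n, hn⟩ := (S.mem_succ_iff _ _).1 hmem
      have hs : (free 𝒜 deg).comp m (single (⟨(m, _, n), hn⟩ : S.Generator) (1 : R)) =
          single (⟨(m, _, n), hn⟩ : S.Generator) (1 : R) := by
        rw [free_comp_single, shift_comp_of_mem SetLike.GradedOne.one_mem, if_pos (by simp)]
      refine ⟨⟨(q : S.Generator →₀ R) - single ⟨(m, _, n), hn⟩ 1, ?_⟩, ?_, ?_⟩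
      · rw [LinearMap.mem_ker, map_sub, linearCombination_single, one_smul, sub_self]
      · intro i hi
        dsimp only
        rw [map_sub, hlt i hi, (free 𝒜 deg).comp_eq_zero_of_homogeneous (by omega) hs,
          sub_zero]
      · dsimp only
        rw [map_sub, hq', (free 𝒜 deg).comp_eq_zero_of_homogeneous (by omega) hs,
          sub_zero]
  eq_zero := by
    rintro p ⟨h1, h2⟩
    ext1
    refine (free 𝒜 deg).eq_zero _ fun i => ?_
    obtain rfl | hi := Nat.eq_zero_or_pos i
    · exact h2.symm
    · exact h1 i hi
  mem_succ_iff := by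
    intro m p
    constructor
    · rintro ⟨h1, h2⟩
      have hm : ∀ i, m < i → (free 𝒜 deg).comp i (p : S.Generator →₀ R) = 0 := by
        intro i hi
        obtain rfl | hi := eq_or_lt_of_le (Nat.succ_le_of_lt hi)
        · exact h2.symm
        · exact h1 i hi
      exact ⟨⟨_, S.comp_mem_ker_of_mem_ker_cover p.2 hm⟩, hm, rfl⟩
    · rintro ⟨q, h1, -⟩
      exact ⟨fun i hi => h1 i (by omega), (h1 _ (by omega)).symm⟩
  smul_mem := by
    rintro i j a p q ha ⟨h1, h2⟩
    refine ⟨fun l hl => ?_, ?_⟩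
    · obtain ⟨l, rfl⟩ := Nat.exists_eq_add_of_le (show i ≤ l by omega)
      have h3 := (free 𝒜 deg).comp_smul i l a (p : S.Generator →₀ R) ha
      rw [h1 l (by omega), smul_zero] at h3
      exact h3
    · have h3 := (free 𝒜 deg).comp_smul i j a (p : S.Generator →₀ R) ha
      dsimp only at h2
      rw [← h2] at h3
      exact h3.symm
  exhaustive := by
    intro p
    obtain ⟨m, hm⟩ := (free 𝒜 deg).bound (p : S.Generator →₀ R)
    exact ⟨m, ⟨_, S.comp_mem_ker_of_mem_ker_cover p.2 hm⟩, hm, rfl⟩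

end Syzygy

end AssociatedGraded

/-- The projective dimension of a filtered module is at most that of its associated graded
module. -/
theorem AssociatedGraded.pdLE {k : Type*} {R : Type u} [Field k] [Ring R] [Algebra k R]
    {𝒜 : ℕ → Submodule k R} [GradedAlgebra 𝒜] (hR : IsConnectedGraded 𝒜) {n : ℕ} {K N : Type u}
    [AddCommGroup K] [Module R K] [AddCommGroup N] [Module R N] (S : AssociatedGraded 𝒜 K N)
    (h : PdLE R N n) : PdLE R K n := by
  induction n generalizing K N with
  | zero =>
    rw [PdLE.zero_iff] at h ⊢
    exact S.projective hR
  | succ n ih =>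
    rw [PdLE.succ_iff S.coverSymbol S.coverSymbol_surjective] at h
    rw [PdLE.succ_iff S.cover S.cover_surjective]
    exact ih S.syzygy h

/-- Over a connected graded algebra, the projective dimensions of all modules are bounded by those
of the modules killed by the augmentation ideal. -/
theorem IsConnectedGraded.pdLE_of_trivial {k : Type*} {R : Type u} [Field k] [Ring R]
    [Algebra k R] {𝒜 : ℕ → Submodule k R} [GradedAlgebra 𝒜] (hR : IsConnectedGraded 𝒜) {n : ℕ}
    (h : ∀ (T : Type u) [AddCommGroup T] [Module R T],
      (∀ a ∈ augmentationIdeal 𝒜, ∀ t : T, a • t = 0) → PdLE R T n)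
    (M : Type u) [AddCommGroup M] [Module R M] : PdLE R M n := by
  let T : Type u := (ModuleCat.restrictScalars (GradedRing.projZeroRingHom 𝒜)).obj
    (ModuleCat.of R M)
  let e : M ≃+ T := AddEquiv.refl M
  have smul_e : ∀ (a : R) (x : M), a • e x = e (GradedRing.projZeroRingHom 𝒜 a • x) :=
    fun _ _ => rfl
  have smul_zero_of_pos : ∀ i, 0 < i → ∀ a ∈ 𝒜 i, ∀ t : T, a • t = 0 := by
    intro i hi a ha t
    obtain ⟨x, rfl⟩ := e.surjective t
    rw [smul_e, show GradedRing.projZeroRingHom 𝒜 a = 0 from mem_augmentationIdeal_of_mem hi ha,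
      zero_smul, map_zero]
  let S : AssociatedGraded 𝒜 M T :=
    { grading :=
        { comp := fun i => if i = 0 then AddMonoidHom.id T else 0
          comp_comp := by
            intro i j x
            by_cases hi : i = 0 <;> by_cases hj : j = 0 <;> simp [hi, hj, eq_comm]
          bound := fun x => ⟨0, fun i hi => by rw [if_neg (by omega)]; rfl⟩
          eq_zero := fun x h => h 0
          comp_smul := by
            intro i j a x ha
            by_cases hi : i = 0
            · subst hi
              rw [zero_add]
              split_ifs
              · rfl
              · exact (smul_zero a).symm
            · rw [smul_zero_of_pos i (by omega) a ha, smul_zero_of_pos i (by omega) a ha, map_zero]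
          comp_smul_lt := by
            intro i j a x ha hj
            rw [smul_zero_of_pos i (by omega) a ha, map_zero] }
      -- The constant filtration: every step is all of `M`, so nonzero symbols occur only in degree
      -- zero.
      symbols := fun j => if j = 0 then e.toAddMonoidHom.graph else AddSubgroup.prod ⊤ ⊥
      homogeneous := by
        rintro (_ | j) x t h
        · rfl
        · obtain rfl : t = 0 := h.2
          rw [map_zero]
      symbol_zero := by
        rintro (_ | j) t h
        · exact h.symm
        · exact h.2
      exists_lift := by
        rintro (_ | j) t h
        · exact ⟨e.symm t, rfl⟩
        · exact ⟨0, trivial, h.symm⟩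
      eq_zero := fun x h => h
      mem_succ_iff := by
        rintro (_ | j) x
        · exact ⟨fun _ => ⟨e x, rfl⟩, fun _ => ⟨trivial, rfl⟩⟩
        · exact ⟨fun _ => ⟨0, trivial, rfl⟩, fun _ => ⟨trivial, rfl⟩⟩
      smul_mem := by
        rintro (_ | i) (_ | j) a x t ha h
        · obtain rfl : e x = t := h
          change e (a • x) = a • e x
          rw [smul_e, GradedRing.projZeroRingHom_apply, DirectSum.decompose_of_mem_same 𝒜 ha]
        · obtain rfl : t = 0 := h.2
          rw [smul_zero]
          exact ⟨trivial, rfl⟩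
        · rw [smul_zero_of_pos _ (Nat.succ_pos i) a ha]
          exact ⟨trivial, rfl⟩
        · rw [smul_zero_of_pos _ (Nat.succ_pos i) a ha]
          exact ⟨trivial, rfl⟩
      exhaustive := fun x => ⟨0, e x, rfl⟩ }
  refine S.pdLE hR (h T ?_)
  intro a ha t
  obtain ⟨x, rfl⟩ := e.surjective t
  rw [smul_e, show GradedRing.projZeroRingHom 𝒜 a = 0 from ha, zero_smul, map_zero]

end Filtered

/-! ### Change of rings along `B → B/(z)` -/

section ChangeOfRings

/-- The ring homomorphism `f : B → A` exhibits `A` as the factor ring `B/(z)` by a regular normal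
element `z`. -/
structure IsRegularNormalQuotient {A B : Type*} [Ring A] [Ring B] (f : B →+* A) (z : B) :
    Prop where
  surjective : Function.Surjective f
  isRegular : IsRegular z
  map_eq_zero_iff_left : ∀ b, f b = 0 ↔ ∃ c, z * c = b
  map_eq_zero_iff_right : ∀ b, f b = 0 ↔ ∃ c, c * z = b

/-- Scalars of `A` lift to `B`, so the map induced on the quotient is `A`-linear. -/
theorem LinearMap.exists_factor_of_surjective {A B X Q Y : Type*} [Ring A] [Ring B] {f : B →+* A}
    (hf : Function.Surjective f)
    [AddCommGroup X] [Module B X] [AddCommGroup Q] [Module A Q] [AddCommGroup Y] [Module A Y]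
    (g : X →ₛₗ[f] Q) (hg : Function.Surjective g) (u : X →ₛₗ[f] Y)
    (h : ∀ x, g x = 0 → u x = 0) : ∃ v : Q →ₗ[A] Y, ∀ x, v (g x) = u x := by
  have h' : ∀ x y, g x = g y → u x = u y := fun x y hxy => by
    rw [← sub_eq_zero, ← map_sub]
    exact h _ (by rw [map_sub, hxy, sub_self])
  choose s hs using hg
  refine ⟨{ toFun := fun q => u (s q), map_add' := fun p q => ?_, map_smul' := fun a q => ?_ },
    fun x => h' _ _ (hs _)⟩
  · rw [← map_add]
    exact h' _ _ (by rw [map_add, hs, hs, hs])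
  · obtain ⟨b, rfl⟩ := hf a
    rw [RingHom.id_apply, ← map_smulₛₗ]
    exact h' _ _ (by rw [map_smulₛₗ, hs, hs])

theorem Finsupp.linearCombination_mapRange_semilinear {A B X Q ι : Type*} [Ring A] [Ring B]
    {f : B →+* A} [AddCommGroup X] [Module B X] [AddCommGroup Q] [Module A Q] (g : X →ₛₗ[f] Q)
    (v : ι → X) (p : ι →₀ B) :
    Finsupp.linearCombination A (fun i => g (v i))
        (Finsupp.mapRange.linearMap f.toSemilinearMap p) =
      g (Finsupp.linearCombination B v p) := by
  induction p using Finsupp.induction_linear with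
  | zero => simp
  | add p q hp hq => simp only [map_add, hp, hq]
  | single i b => simp [map_smulₛₗ]

namespace IsRegularNormalQuotient

variable {A B : Type u} [Ring A] [Ring B] {f : B →+* A} {z : B}

theorem map_self (hf : IsRegularNormalQuotient f z)
    : f z = 0 := (hf.map_eq_zero_iff_left z).2 ⟨1, mul_one z⟩

theorem exists_commutation (hf : IsRegularNormalQuotient f z) (b : B) : ∃ c, z * c = b * z :=
  (hf.map_eq_zero_iff_left _).1 (by rw [map_mul, hf.map_self, mul_zero])

theorem mapRange_surjective (hf : IsRegularNormalQuotient f z) (ι : Type*) : Function.Surjective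
    (Finsupp.mapRange.linearMap f.toSemilinearMap : (ι →₀ B) →ₛₗ[f] (ι →₀ A)) :=
  Finsupp.mapRange_surjective f (map_zero f) hf.surjective

theorem exists_smul_eq_of_mapRange_eq_zero (hf : IsRegularNormalQuotient f z)
    {ι : Type*} {p : ι →₀ B}
    (hp : Finsupp.mapRange.linearMap f.toSemilinearMap p = 0) : ∃ q, z • q = p := by
  have h : ∀ b, ∃ c, f b = 0 → z * c = b := fun b => by
    by_cases hb : f b = 0
    · obtain ⟨c, hc⟩ := (hf.map_eq_zero_iff_left b).1 hb
      exact ⟨c, fun _ => hc⟩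
    · exact ⟨0, fun h => absurd h hb⟩
  choose c hc using h
  -- Finite support of the quotient by `z` requires `c 0 = 0`, which regularity forces.
  refine ⟨Finsupp.mapRange c (hf.isRegular.left ?_) p, ?_⟩
  · change z * c 0 = z * 0
    rw [hc 0 (map_zero f), mul_zero]
  · ext i
    exact hc _ (DFunLike.congr_fun hp i)

/-- Factoring out a regular normal element which is regular on `X` does not increase the projective
dimension of `X`. -/
theorem pdLE_of_surjective (hf : IsRegularNormalQuotient f z)
    {n : ℕ} {X Q : Type u} [AddCommGroup X] [Module B X] [AddCommGroup Q]
    [Module A Q] (g : X →ₛₗ[f] Q) (hg : Function.Surjective g)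
    (hker : ∀ x, g x = 0 ↔ ∃ y, z • y = x) (hX : ∀ x : X, z • x = 0 → x = 0)
    (h : PdLE B X n) : PdLE A Q n := by
  induction n generalizing X Q with
  | zero =>
    rw [PdLE.zero_iff] at h
    obtain ⟨s, hs⟩ := h.out
    -- A section of the free cover of `X` sends multiples of `z` to multiples of `z`, so it descends
    -- to a section of the free cover of `Q`.
    obtain ⟨σ, hσ⟩ := LinearMap.exists_factor_of_surjective hf.surjective g hg
      ((Finsupp.mapRange.linearMap f.toSemilinearMap : (X →₀ B) →ₛₗ[f] (X →₀ A)).comp s) <| by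
        intro x hx
        obtain ⟨y, rfl⟩ := (hker x).1 hx
        rw [LinearMap.comp_apply, map_smul, map_smulₛₗ, hf.map_self, zero_smul]
    refine PdLE.of_leftInverse σ (Finsupp.linearCombination A g) (fun q => ?_)
      (PdLE.of_projective 0)
    obtain ⟨x, rfl⟩ := hg q
    rw [hσ]
    exact (Finsupp.linearCombination_mapRange_semilinear g id (s x)).trans
      (congrArg g (hs x))
  | succ n ih =>
    let φ : (X →₀ B) →ₗ[B] X := Finsupp.linearCombination B id
    let ψ : (X →₀ A) →ₗ[A] Q := Finsupp.linearCombination A g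
    let ρ : (X →₀ B) →ₛₗ[f] (X →₀ A) := Finsupp.mapRange.linearMap f.toSemilinearMap
    have hρ : ∀ p, ψ (ρ p) = g (φ p) := Finsupp.linearCombination_mapRange_semilinear g id
    have hφ : Function.Surjective φ := Finsupp.linearCombination_id_surjective B X
    have hψ : Function.Surjective ψ := fun q => by
      obtain ⟨x, rfl⟩ := hg q
      exact ⟨Finsupp.single x 1, by simp [ψ]⟩
    rw [PdLE.succ_iff φ hφ] at h
    rw [PdLE.succ_iff ψ hψ]
    have hreg : ∀ p : X →₀ B, z • p = 0 → p = 0 := fun p hp => by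
      ext i
      exact hf.isRegular.left ((DFunLike.congr_fun hp i).trans (mul_zero z).symm)
    -- The kernel of `ψ` is again the reduction of the kernel of `φ` modulo `z`: a lift is corrected
    -- by a multiple of `z`, and regularity of `z` on `X` shows that `z • q` lies in the kernel of
    -- `φ` only if `q` does.
    refine ih ((ρ.comp φ.ker.subtype).codRestrict ψ.ker fun p => ?_) ?_ ?_ ?_ h
    · rw [LinearMap.mem_ker, LinearMap.comp_apply, hρ, Submodule.subtype_apply,
        LinearMap.mem_ker.1 p.2, map_zero]
    · rintro ⟨q, hq⟩
      obtain ⟨p, rfl⟩ := hf.mapRange_surjective X q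
      rw [LinearMap.mem_ker] at hq
      obtain ⟨x, hx⟩ := (hker _).1 ((hρ p).symm.trans hq)
      obtain ⟨y, rfl⟩ := hφ x
      refine ⟨⟨p - z • y, ?_⟩, ?_⟩
      · rw [LinearMap.mem_ker, map_sub, map_smul, hx, sub_self]
      · ext1
        change ρ (p - z • y) = ρ p
        rw [map_sub, map_smulₛₗ, hf.map_self, zero_smul, sub_zero]
    · rintro ⟨p, hp⟩
      constructor
      · intro h0
        obtain ⟨q, rfl⟩ := hf.exists_smul_eq_of_mapRange_eq_zero (congrArg Subtype.val h0)
        refine ⟨⟨q, hX _ ?_⟩, rfl⟩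
        rw [← map_smul]
        exact hp
      · rintro ⟨q, hq⟩
        rw [← hq, map_smulₛₗ, hf.map_self, zero_smul]
    · rintro ⟨p, hp⟩ h0
      exact Subtype.ext (hreg p (congrArg Subtype.val h0))

-- Right multiplication by `z` is an injective `B`-linear endomorphism of the free `B`-module with
-- this cokernel, giving a free resolution of length one.
open CategoryTheory in
theorem pdLE_one_restrictScalars_finsupp (hf : IsRegularNormalQuotient f z) (ι : Type u) :
    PdLE B ((ModuleCat.restrictScalars f).obj (ModuleCat.of A (ι →₀ A))) 1 := by
  let Y := (ModuleCat.restrictScalars f).obj (ModuleCat.of A (ι →₀ A))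
  let ρ : (ι →₀ B) →ₛₗ[f] (ι →₀ A) := Finsupp.mapRange.linearMap f.toSemilinearMap
  let π : (ι →₀ B) →ₗ[B] Y :=
    { toFun := ρ
      map_add' := ρ.map_add
      map_smul' := ρ.map_smulₛₗ }
  let μ : (ι →₀ B) →ₗ[B] (ι →₀ B) :=
    Finsupp.mapRange.linearMap (LinearMap.toSpanSingleton B B z)
  have hμ : Function.Injective μ :=
    Finsupp.mapRange_injective _ (map_zero _) fun a b hab => hf.isRegular.right hab
  have hrange : μ.range = π.ker := by
    ext p
    constructor
    · rintro ⟨q, rfl⟩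
      refine Finsupp.ext fun i => ?_
      change f (q i * z) = 0
      rw [map_mul, hf.map_self, mul_zero]
    · intro hp
      have h : ∀ b, ∃ c, f b = 0 → c * z = b := fun b => by
        by_cases hb : f b = 0
        · obtain ⟨c, hc⟩ := (hf.map_eq_zero_iff_right b).1 hb
          exact ⟨c, fun _ => hc⟩
        · exact ⟨0, fun h => absurd h hb⟩
      choose c hc using h
      refine ⟨Finsupp.mapRange c (hf.isRegular.right ?_) p, ?_⟩
      · change c 0 * z = 0 * z
        rw [hc 0 (map_zero f), zero_mul]
      · ext i
        have hp' : ρ p = 0 := hp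
        exact hc _ (DFunLike.congr_fun hp' i)
  rw [PdLE.succ_iff π (hf.mapRange_surjective ι), PdLE.zero_iff]
  exact Module.Projective.of_equiv
    ((LinearEquiv.ofInjective μ hμ).trans (LinearEquiv.ofEq _ _ hrange))

open CategoryTheory in
/-- Over `B`, the projective dimension of an `A`-module increases by at most one. -/
theorem pdLE_restrictScalars (hf : IsRegularNormalQuotient f z)
    {n : ℕ} {Q : Type u} [AddCommGroup Q] [Module A Q]
    (h : PdLE A Q n) :
    PdLE B ((ModuleCat.restrictScalars f).obj (ModuleCat.of A Q)) (n + 1) := by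
  induction n generalizing Q with
  | zero =>
    rw [PdLE.zero_iff] at h
    obtain ⟨s, hs⟩ := h.out
    let r : Retract (ModuleCat.of A Q) (ModuleCat.of A (Q →₀ A)) :=
      ⟨ModuleCat.ofHom s, ModuleCat.ofHom (Finsupp.linearCombination A id), by ext x; exact hs x⟩
    have : HasProjectiveDimensionLT
        ((ModuleCat.restrictScalars f).obj (ModuleCat.of A (Q →₀ A))) 2 :=
      hf.pdLE_one_restrictScalars_finsupp Q
    exact (r.map (ModuleCat.restrictScalars f)).hasProjectiveDimensionLT 2
  | succ n ih =>
    have hsurj := Finsupp.linearCombination_id_surjective A Q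
    rw [PdLE.succ_iff _ hsurj] at h
    have hexact : ((PdLE.kerComplex
        (Finsupp.linearCombination A (id : Q → Q))).map (ModuleCat.restrictScalars f)).ShortExact :=
      { exact := by
          rw [ShortComplex.moduleCat_exact_iff]
          intro x hx
          exact ⟨⟨x, hx⟩, rfl⟩
        mono_f := (ModuleCat.mono_iff_injective _).2 Subtype.val_injective
        epi_g := (ModuleCat.epi_iff_surjective _).2 hsurj }
    exact hexact.hasProjectiveDimensionLT_X₃ (n + 2) (ih h)
      ((hf.pdLE_one_restrictScalars_finsupp Q).mono (by omega))

/-- A `B`-module killed by the kernel of `f` is an `A`-module. -/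
theorem exists_module (hf : IsRegularNormalQuotient f z) {X : Type*} [AddCommGroup X] [Module B X]
    (hX : ∀ b, f b = 0 → ∀ x : X, b • x = 0) :
    ∃ _ : Module A X, ∀ (b : B) (x : X), f b • x = b • x := by
  let F : A →+* AddMonoid.End X := f.liftOfRightInverse _
    (Function.rightInverse_surjInv hf.surjective)
    ⟨Module.toAddMonoidEnd B X, fun b hb => by ext x; exact hX b hb x⟩
  refine ⟨Module.compHom X F, fun b x => ?_⟩
  change F (f b) x = _
  rw [RingHom.liftOfRightInverse_comp_apply]
  rfl

/-- The `A`-module `X/zX`. -/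
theorem exists_quotient (hf : IsRegularNormalQuotient f z)
    (X : Type u) [AddCommGroup X] [Module B X] :
    ∃ (Q : Type u) (_ : AddCommGroup Q) (_ : Module A Q) (g : X →ₛₗ[f] Q),
      Function.Surjective g ∧ ∀ x, g x = 0 ↔ ∃ y, z • y = x := by
  let W : Submodule B X :=
    { carrier := {x | ∃ y, z • y = x}
      zero_mem' := ⟨0, smul_zero _⟩
      add_mem' := by
        rintro _ _ ⟨x, rfl⟩ ⟨y, rfl⟩
        exact ⟨x + y, smul_add _ _ _⟩
      smul_mem' := by
        rintro b _ ⟨x, rfl⟩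
        obtain ⟨b', hb'⟩ := hf.exists_commutation b
        exact ⟨b' • x, by rw [smul_smul, hb', mul_smul]⟩ }
  obtain ⟨inst, hsmul⟩ := hf.exists_module (X := X ⧸ W) <| by
    intro b hb x
    obtain ⟨b', rfl⟩ := (hf.map_eq_zero_iff_left b).1 hb
    obtain ⟨x, rfl⟩ := W.mkQ_surjective x
    rw [← map_smul]
    exact (Submodule.Quotient.mk_eq_zero W).2 ⟨b' • x, by rw [smul_smul]⟩
  exact ⟨X ⧸ W, inferInstance, inst,
    { toFun := W.mkQ
      map_add' := map_add _
      map_smul' := fun b x => by rw [map_smul, hsmul] },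
    W.mkQ_surjective, fun x => Submodule.Quotient.mk_eq_zero W⟩

/-- If the `A`-modules have projective dimension at most `n`, then the `B`-modules that are killed
by the kernel of `f` have projective dimension at most `n + 1`. -/
theorem pdLE_of_forall_pdLE (hf : IsRegularNormalQuotient f z)
    {n : ℕ} (h : ∀ (Q : Type u) [AddCommGroup Q] [Module A Q], PdLE A Q n)
    {X : Type u} [AddCommGroup X] [Module B X] (hX : ∀ b, f b = 0 → ∀ x : X, b • x = 0) :
    PdLE B X (n + 1) := by
  obtain ⟨_, hsmul⟩ := hf.exists_module hX
  let Y := (ModuleCat.restrictScalars f).obj (ModuleCat.of A X)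
  let e : X ≃ₗ[B] Y :=
    { AddEquiv.refl X with
      map_smul' := fun b x => (hsmul b x).symm }
  exact (hf.pdLE_restrictScalars (h X)).of_equiv e

end IsRegularNormalQuotient

end ChangeOfRings

/-! ### Modules killed by the augmentation ideal as summands of X/zX -/

section ConnectedQuotient

variable {k : Type*} {A B : Type u} [Field k] [Ring A] [Ring B] [Algebra k B]
  {𝒜 : ℕ → Submodule k B} [GradedAlgebra 𝒜] {f : B →+* A} {z : B}

theorem mul_mem_augmentationIdeal_right {a : B} (ha : a ∈ augmentationIdeal 𝒜) (b : B) :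
    a * b ∈ augmentationIdeal 𝒜 := by
  change GradedRing.projZeroRingHom 𝒜 (a * b) = 0
  rw [map_mul, show GradedRing.projZeroRingHom 𝒜 a = 0 from ha, zero_mul]

theorem decompose_mul_one_of_mem {a b : B} (ha : a ∈ augmentationIdeal 𝒜)
    (hb : b ∈ augmentationIdeal 𝒜) : (DirectSum.decompose 𝒜 (a * b) 1 : B) = 0 := by
  classical
  rw [← DirectSum.sum_support_decompose 𝒜 a, Finset.sum_mul, DirectSum.decompose_sum,
    DFinsupp.finsetSum_apply, AddSubmonoidClass.coe_finsetSum]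
  refine Finset.sum_eq_zero fun i _ => ?_
  obtain rfl | hi := Nat.eq_zero_or_pos i
  · rw [mem_augmentationIdeal.1 ha, zero_mul, DirectSum.decompose_zero]; rfl
  · obtain rfl | hi := eq_or_lt_of_le (Nat.succ_le_of_lt hi)
    · refine (DirectSum.coe_decompose_mul_add_of_left_mem (j := 0) 𝒜 (SetLike.coe_mem _)).trans ?_
      rw [mem_augmentationIdeal.1 hb, mul_zero]
    · exact DirectSum.coe_decompose_mul_of_left_mem_of_not_le 𝒜 (SetLike.coe_mem _) (by omega)

/-- A linear functional which is `1` at a given nonzero element of degree one and vanishes on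
products of elements of the augmentation ideal. -/
theorem exists_degree_one_functional (hz : z ∈ 𝒜 1) (hz0 : z ≠ 0) :
    ∃ l : B →ₗ[k] k, l z = 1 ∧
      ∀ a ∈ augmentationIdeal 𝒜, ∀ b ∈ augmentationIdeal 𝒜, l (a * b) = 0 := by
  obtain ⟨μ, hμ⟩ := Module.exists_dual_forall_apply_eq_one (K := k) (s := {z})
    (v := id) (by simpa using hz0)
  refine ⟨μ.comp (GradedAlgebra.proj 𝒜 1), ?_, fun a ha b hb => ?_⟩
  · rw [LinearMap.comp_apply, GradedAlgebra.proj_apply, DirectSum.decompose_of_mem_same 𝒜 hz]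
    exact hμ z rfl
  · rw [LinearMap.comp_apply, GradedAlgebra.proj_apply, decompose_mul_one_of_mem ha hb, map_zero]

namespace IsRegularNormalQuotient

theorem ne_zero_of_nontrivial (hf : IsRegularNormalQuotient f z) [Nontrivial B] : z ≠ 0 := by
  rintro rfl
  exact one_ne_zero (hf.isRegular.left (by simp : (0 : B) * 1 = 0 * 0))

/-- Comparing degree one components gives `z * c₀ = b₀ * z = 0`, and `z` cancels. -/
theorem mem_augmentationIdeal_of_commutation (hf : IsRegularNormalQuotient f z)
    (hz : z ∈ 𝒜 1) {b c : B} (h : z * c = b * z)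
    (hb : b ∈ augmentationIdeal 𝒜) : c ∈ augmentationIdeal 𝒜 := by
  have h1 := DirectSum.coe_decompose_mul_add_of_left_mem (j := 0) (b := c) 𝒜 hz
  have h2 := DirectSum.coe_decompose_mul_add_of_right_mem (i := 0) (a := b) 𝒜 hz
  rw [add_zero, h] at h1
  rw [zero_add, h1, mem_augmentationIdeal.1 hb, zero_mul] at h2
  exact hf.isRegular.left (h2.trans (mul_zero z).symm)

theorem map_eq_zero_imp_mem (hf : IsRegularNormalQuotient f z)
    (hz : z ∈ 𝒜 1) {b : B} (hb : f b = 0) :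
    b ∈ augmentationIdeal 𝒜 := by
  obtain ⟨c, rfl⟩ := (hf.map_eq_zero_iff_left b).1 hb
  exact mul_mem_augmentationIdeal_right (mem_augmentationIdeal_of_mem one_pos hz) c

/-- If the `B`-modules have projective dimension at most `n + 1`, then the `A`-modules killed by
the augmentation ideal have projective dimension at most `n`. -/
theorem pdLE_of_trivial (hf : IsRegularNormalQuotient f z)
    (hB : IsConnectedGraded 𝒜) (hz : z ∈ 𝒜 1) {n : ℕ}
    (h : ∀ (M : Type u) [AddCommGroup M] [Module B M], PdLE B M (n + 1))
    {T : Type u} [AddCommGroup T] [Module A T]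
    (hT : ∀ a ∈ augmentationIdeal 𝒜, ∀ t : T, f a • t = 0) : PdLE A T n := by
  have : Nontrivial B := hB.algebraMap_injective.nontrivial
  let _ : Module B T := Module.compHom T f
  let _ : Module k T := Module.compHom T (f.comp (algebraMap k B))
  have smul_k : ∀ (c : k) (t : T), c • t = f (algebraMap k B c) • t := fun _ _ => rfl
  have smul_of_sub_mem : ∀ (b : B) (c : k), b - algebraMap k B c ∈ augmentationIdeal 𝒜 →
      ∀ t : T, f b • t = c • t := fun b c hb t => by
    rw [smul_k, ← sub_eq_zero, ← sub_smul, ← map_sub]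
    exact hT _ hb t
  have hzaug : z ∈ augmentationIdeal 𝒜 := mem_augmentationIdeal_of_mem one_pos hz
  obtain ⟨l, hlz, hl⟩ := exists_degree_one_functional hz hf.ne_zero_of_nontrivial
  have hl_smul : ∀ (b : B) (c : k), b - algebraMap k B c ∈ augmentationIdeal 𝒜 →
      ∀ a ∈ augmentationIdeal 𝒜, l (b * a) = c * l a := fun b c hb a ha => by
    have := hl _ hb a ha
    rwa [sub_mul, map_sub, ← Algebra.smul_def, map_smul, sub_eq_zero] at this
  let e := Module.Basis.ofVectorSpace k T
  let φ : (Module.Basis.ofVectorSpaceIndex k T →₀ B) →ₗ[B] T := Finsupp.linearCombination B e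
  have hφ_single : ∀ i b, φ (Finsupp.single i b) = f b • e i := fun i b =>
    Finsupp.linearCombination_single _ _ _
  have hφ : Function.Surjective φ := by
    intro t
    have ht := e.mem_span t
    induction ht using Submodule.span_induction with
    | zero => exact ⟨0, map_zero _⟩
    | add x y _ _ hx hy =>
      obtain ⟨p, rfl⟩ := hx
      obtain ⟨q, rfl⟩ := hy
      exact ⟨p + q, map_add _ _ _⟩
    | smul c x _ hx =>
      obtain ⟨p, rfl⟩ := hx
      exact ⟨algebraMap k B c • p, map_smul _ _ _⟩
    | mem x hx =>
      obtain ⟨i, rfl⟩ := hx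
      exact ⟨Finsupp.single i 1, by rw [hφ_single, map_one, one_smul]⟩
  choose c hc using fun b => hB.exists_algebraMap_sub_mem (𝒜 := 𝒜) b
  have hker : ∀ p, φ p = 0 → ∀ i, p i ∈ augmentationIdeal 𝒜 := by
    intro p hp i
    have h0 : ∑ j ∈ p.support, c (p j) • e j = 0 := by
      rw [← hp]
      exact Finset.sum_congr rfl fun j _ => (smul_of_sub_mem _ _ (hc _) _).symm
    by_cases hi : i ∈ p.support
    · have := hc (p i)
      rwa [linearIndependent_iff'.1 e.linearIndependent p.support (fun j => c (p j)) h0 i hi,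
        map_zero, sub_zero] at this
    · rw [Finsupp.notMem_support_iff.1 hi]
      exact zero_mem _
  have hmem : ∀ p, (∀ i, p i ∈ augmentationIdeal 𝒜) → φ p = 0 := fun p hp =>
    Finset.sum_eq_zero fun i _ => hT _ (hp i) _
  -- By `hker` and `hmem`, `X` consists of the vectors with coordinates in the augmentation ideal.
  -- The quotient `Q` = X/zX has the required bound; it remains to make `T` a retract of it.
  let X := φ.ker
  obtain ⟨Q, _, _, g, hg, hgker⟩ := hf.exists_quotient X
  have hX : ∀ x : X, z • x = 0 → x = 0 := fun x hx => by
    ext i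
    exact hf.isRegular.left
      ((DFunLike.congr_fun (congrArg Subtype.val hx) i).trans (mul_zero z).symm)
  have hQ : PdLE A Q n :=
    hf.pdLE_of_surjective g hg hgker hX ((PdLE.succ_iff φ hφ n).1 (h T))
  -- The retraction applies `l` to each coordinate. As `l` kills products of elements of the
  -- augmentation ideal, it is semilinear on `X` and vanishes on zX.
  let ν : (Module.Basis.ofVectorSpaceIndex k T →₀ B) →ₗ[k] T :=
    (Finsupp.linearCombination k e).comp (Finsupp.mapRange.linearMap l)
  have hν_single : ∀ i b, ν (Finsupp.single i b) = l b • e i := fun i b => by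
    simp [ν]
  have hν_zero : ∀ p, (∀ i, l (p i) = 0) → ν p = 0 := fun p hp => by
    have : Finsupp.mapRange.linearMap l p = 0 := Finsupp.ext hp
    rw [LinearMap.comp_apply, this, map_zero]
  let u : X →ₛₗ[f] T :=
    { toFun := fun x => ν x
      map_add' := fun x y => map_add ν _ _
      map_smul' := fun b x => by
        rw [smul_of_sub_mem b (c b) (hc b), ← map_smul, ← sub_eq_zero, ← map_sub]
        refine hν_zero _ fun i => ?_
        change l (b * (x : _ →₀ B) i - c b • (x : _ →₀ B) i) = 0
        rw [map_sub, map_smul, hl_smul b (c b) (hc b) _ (hker x x.2 i), smul_eq_mul, sub_self] }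
  have hu : ∀ x, g x = 0 → u x = 0 := by
    intro x hx
    obtain ⟨y, rfl⟩ := (hgker x).1 hx
    exact hν_zero _ fun i => hl _ hzaug _ (hker y y.2 i)
  obtain ⟨r, hr⟩ := LinearMap.exists_factor_of_surjective (X := X) hf.surjective g hg u hu
  -- The embedding of `T` comes from right multiplication by `z`, which is left `B`-linear.
  let μ : (Module.Basis.ofVectorSpaceIndex k T →₀ B) →ₗ[B] X :=
    (Finsupp.mapRange.linearMap (LinearMap.toSpanSingleton B B z)).codRestrict X fun p =>
      hmem _ fun i => (augmentationIdeal 𝒜).mul_mem_left (p i) hzaug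
  obtain ⟨i, hi⟩ := LinearMap.exists_factor_of_surjective hf.surjective
    (Q := T) (X := Module.Basis.ofVectorSpaceIndex k T →₀ B)
    { toFun := φ
      map_add' := map_add φ
      map_smul' := fun b p => map_smul φ b p } hφ (g.comp μ) <| by
    intro p hp
    -- Normality moves `z` to the left: if `p` lies in `X`, then pz = zp' with p' again in `X`, so
    -- the map descends to `T`.
    choose s hs using hf.exists_commutation
    have hs0 : s 0 = 0 := hf.isRegular.left (by
      change z * s 0 = z * 0
      rw [hs, zero_mul, mul_zero])
    refine (hgker _).2 ⟨⟨Finsupp.mapRange s hs0 p, hmem _ fun j => ?_⟩, ?_⟩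
    · exact hf.mem_augmentationIdeal_of_commutation hz (hs _) (hker p hp j)
    · ext j
      exact hs _
  refine hQ.of_leftInverse i r fun t => ?_
  obtain ⟨p, rfl⟩ := hφ t
  have h1 : i (φ p) = g (μ p) := hi p
  have h2 : r (g (μ p)) = ν (μ p) := hr _
  rw [h1, h2]
  clear h1 h2
  change ν (Finsupp.mapRange.linearMap (LinearMap.toSpanSingleton B B z) p) = _
  induction p using Finsupp.induction_linear with
  | zero => simp only [map_zero]
  | add p q hp hq => simp only [map_add, hp, hq]
  | single j b =>
    -- The composite is the identity because `l` reads off from `b * z` the constant term of `b`, by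
    -- which `b` acts on `T`.
    have hbz : l (b * z) = c b := by rw [hl_smul b (c b) (hc b) z hzaug, hlz, mul_one]
    rw [Finsupp.mapRange.linearMap_apply, Finsupp.mapRange_single, hν_single, hφ_single,
      smul_of_sub_mem b (c b) (hc b), LinearMap.toSpanSingleton_apply, smul_eq_mul, hbz]

end IsRegularNormalQuotient

end ConnectedQuotient

/-! ### The grading on the factor ring -/

section GradedQuotient

variable {k : Type*} {A B : Type*} [Field k] [Ring A] [Ring B] [Algebra k A] [Algebra k B]
  {𝒜 : ℕ → Submodule k B} [GradedAlgebra 𝒜]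

/-- The image of a grading under a surjective linear map with graded kernel is a direct sum
decomposition. -/
theorem DirectSum.isInternal_map_of_surjective (l : B →ₗ[k] A) (hl : Function.Surjective l)
    (hker : ∀ b, l b = 0 → ∀ i, l (DirectSum.decompose 𝒜 b i) = 0) :
    DirectSum.IsInternal fun n => (𝒜 n).map l := by
  classical
  let q : ∀ n, 𝒜 n →+ (𝒜 n).map l := fun n =>
    ((l.comp (𝒜 n).subtype).codRestrict ((𝒜 n).map l) fun x => ⟨x, x.2, rfl⟩).toAddMonoidHom
  have hq : ∀ n, Function.Surjective (q n) := by
    rintro n ⟨_, x, hx, rfl⟩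
    exact ⟨⟨x, hx⟩, rfl⟩
  have hcoe : ∀ y : DirectSum ℕ fun n => 𝒜 n,
      DirectSum.coeAddMonoidHom (fun n => (𝒜 n).map l) (DirectSum.map q y) =
        l (DirectSum.coeAddMonoidHom 𝒜 y) := by
    intro y
    induction y using DirectSum.induction_on with
    | zero => simp
    | of i x =>
      simp only [DirectSum.map_of, DirectSum.coeAddMonoidHom_of]
      rfl
    | add x y hx hy => simp only [map_add, hx, hy]
  have hdec : ∀ y : DirectSum ℕ fun n => 𝒜 n,
      DirectSum.decompose 𝒜 (DirectSum.coeAddMonoidHom 𝒜 y) = y :=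
    DirectSum.Decomposition.right_inv
  constructor
  · rw [injective_iff_map_eq_zero]
    intro x hx
    obtain ⟨y, rfl⟩ := (DirectSum.map_surjective q).2 hq x
    rw [hcoe] at hx
    ext i
    have := hker _ hx i
    rw [hdec] at this
    exact this
  · intro a
    obtain ⟨b, rfl⟩ := hl a
    exact ⟨DirectSum.map q (DirectSum.decompose 𝒜 b), by
      rw [hcoe]
      exact congrArg l (DirectSum.Decomposition.left_inv b)⟩

end GradedQuotient

namespace IsRegularNormalQuotient

/-- The ideal generated by the homogeneous element `z` is graded, so the factor ring inherits the
grading. -/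
theorem map_decompose_eq_zero {k : Type*} {A B : Type u} [Field k] [Ring A] [Ring B] [Algebra k B]
    {𝒜 : ℕ → Submodule k B} [GradedAlgebra 𝒜] {f : B →+* A} {z : B}
    (hf : IsRegularNormalQuotient f z) (hz : z ∈ 𝒜 1) {b : B} (hb : f b = 0) (i : ℕ) :
    f (DirectSum.decompose 𝒜 b i) = 0 := by
  obtain ⟨c, rfl⟩ := (hf.map_eq_zero_iff_left b).1 hb
  obtain _ | i := i
  · rw [DirectSum.coe_decompose_mul_of_left_mem_of_not_le 𝒜 hz (by omega), map_zero]
  · rw [add_comm i 1, DirectSum.coe_decompose_mul_add_of_left_mem 𝒜 hz, map_mul, hf.map_self,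
      zero_mul]

/-- The factor algebra of a connected graded algebra by a homogeneous regular normal element of
degree one is connected graded. -/
theorem exists_connected_grading {k : Type*} {A B : Type u} [Field k] [Ring A] [Ring B]
    [Algebra k B] {𝒜 : ℕ → Submodule k B} [GradedAlgebra 𝒜] {f : B →+* A} {z : B}
    (hf : IsRegularNormalQuotient f z) (hB : IsConnectedGraded 𝒜) (hz : z ∈ 𝒜 1) :
    ∃ (_ : Algebra k A) (𝒜' : ℕ → Submodule k A) (_ : GradedAlgebra 𝒜'),
      IsConnectedGraded 𝒜' ∧
        ∀ b ∈ augmentationIdeal 𝒜, f b ∈ augmentationIdeal 𝒜' := by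
  classical
  let _ : Algebra k A := (f.comp (algebraMap k B)).toAlgebra' fun c a => by
    obtain ⟨b, rfl⟩ := hf.surjective a
    rw [RingHom.comp_apply, ← map_mul, ← map_mul, Algebra.commutes]
  have halg : ∀ c, algebraMap k A c = f (algebraMap k B c) := fun _ => rfl
  let l : B →ₗ[k] A :=
    { toFun := f
      map_add' := map_add f
      map_smul' := fun c b => by
        rw [Algebra.smul_def, map_mul, RingHom.id_apply, Algebra.smul_def, halg] }
  let 𝒜' : ℕ → Submodule k A := fun n => (𝒜 n).map l
  have hint : DirectSum.IsInternal 𝒜' :=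
    DirectSum.isInternal_map_of_surjective l hf.surjective
      fun b hb i => hf.map_decompose_eq_zero hz hb i
  have hmonoid : SetLike.GradedMonoid 𝒜' :=
    { one_mem := ⟨1, SetLike.GradedOne.one_mem, map_one f⟩
      mul_mem := by
        rintro i j _ _ ⟨a, ha, rfl⟩ ⟨b, hb, rfl⟩
        exact ⟨a * b, SetLike.mul_mem_graded ha hb, map_mul f a b⟩ }
  let hgraded : GradedAlgebra 𝒜' :=
    { hmonoid, hint.chooseDecomposition with }
  refine ⟨inferInstance, 𝒜', hgraded, ⟨?_, ?_⟩, ?_⟩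
  · rw [injective_iff_map_eq_zero]
    intro c hc
    exact hB.eq_zero_of_algebraMap_mem (hf.map_eq_zero_imp_mem hz hc)
  · intro a
    constructor
    · rintro ⟨b, hb, rfl⟩
      obtain ⟨c, rfl⟩ := (hB.mem_zero_iff b).1 hb
      exact ⟨c, rfl⟩
    · rintro ⟨c, rfl⟩
      exact ⟨algebraMap k B c, (hB.mem_zero_iff _).2 ⟨c, rfl⟩, rfl⟩
  · intro b hb
    rw [← DirectSum.sum_support_decompose 𝒜 b, map_sum]
    refine sum_mem fun i _ => ?_
    obtain rfl | hi := Nat.eq_zero_or_pos i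
    · rw [mem_augmentationIdeal.1 hb, map_zero]
      exact zero_mem _
    · exact mem_augmentationIdeal_of_mem hi ⟨_, SetLike.coe_mem _, rfl⟩

variable {k : Type*} {A B : Type u} [Field k] [Ring A] [Ring B] [Algebra k B]
  {𝒜 : ℕ → Submodule k B} [GradedAlgebra 𝒜] {f : B →+* A} {z : B}

/-- Otherwise the quotient by the augmentation ideal would embed in `B`; but `z` kills it and kills
no nonzero element of `B`. -/
theorem not_forall_projective (hf : IsRegularNormalQuotient f z) (hB : IsConnectedGraded 𝒜)
    (hz : z ∈ 𝒜 1) : ¬ ∀ (M : Type u) [AddCommGroup M] [Module B M], PdLE B M 0 := by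
  intro h
  have hproj := PdLE.zero_iff.1 (h (B ⧸ augmentationIdeal 𝒜))
  obtain ⟨s, hs⟩ := Module.projective_lifting_property (augmentationIdeal 𝒜).mkQ
    LinearMap.id (augmentationIdeal 𝒜).mkQ_surjective
  have hs' : ∀ x, (augmentationIdeal 𝒜).mkQ (s x) = x := LinearMap.congr_fun hs
  let x := (augmentationIdeal 𝒜).mkQ 1
  have hzx : z • x = 0 := by
    rw [← map_smul, smul_eq_mul, mul_one]
    exact (Submodule.Quotient.mk_eq_zero _).2 (mem_augmentationIdeal_of_mem one_pos hz)
  have hsx : s x = 0 := hf.isRegular.left (by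
    change z • s x = z * 0
    rw [← map_smul, hzx, map_zero, mul_zero])
  have hx : x = 0 := by rw [← hs' x, hsx, map_zero]
  have h1 : (1 : B) ∈ augmentationIdeal 𝒜 := (Submodule.Quotient.mk_eq_zero _).1 hx
  rw [← map_one (algebraMap k B)] at h1
  exact one_ne_zero (hB.eq_zero_of_algebraMap_mem h1)

/-- The global dimension of the factor ring of a connected graded algebra of finite global
dimension by a regular normal element of degree one. -/
theorem leftGlobalDimension_add_one (hf : IsRegularNormalQuotient f z) (hB : IsConnectedGraded 𝒜)
    (hz : z ∈ 𝒜 1) {d : ℕ} (hd : leftGlobalDimension B = d) :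
    leftGlobalDimension A + 1 = d := by
  have hdB := (leftGlobalDimension_le_iff B d).1 hd.le
  obtain _ | n := d
  · exact absurd hdB (hf.not_forall_projective hB hz)
  obtain ⟨_, 𝒜', _, hA, haug⟩ := hf.exists_connected_grading hB hz
  have : Nontrivial A := hA.algebraMap_injective.nontrivial
  have hle : leftGlobalDimension A ≤ n := (leftGlobalDimension_le_iff A n).2 <|
    hA.pdLE_of_trivial fun T _ _ hT => hf.pdLE_of_trivial hB hz hdB fun a ha t =>
      hT _ (haug a ha) t
  obtain ⟨m, hm⟩ : ∃ m : ℕ, leftGlobalDimension A = m := by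
    obtain ⟨e, he⟩ := WithBot.ne_bot_iff_exists.1 (leftGlobalDimension_ne_bot A)
    rw [← he] at hle
    have he' : e ≠ ⊤ := ne_top_of_le_ne_top (ENat.natCast_ne_top n) (WithBot.coe_le_coe.1 hle)
    obtain ⟨m, rfl⟩ := ENat.ne_top_iff_exists.1 he'
    exact ⟨m, he.symm⟩
  -- The kernel of `f` lies in the augmentation ideal, so the test modules for `B` are `A`-modules.
  have hge : leftGlobalDimension B ≤ (m + 1 : ℕ) := (leftGlobalDimension_le_iff B (m + 1)).2 <|
    hB.pdLE_of_trivial fun T _ _ hT =>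
      hf.pdLE_of_forall_pdLE ((leftGlobalDimension_le_iff A m).1 hm.le) fun b hb =>
        hT b (hf.map_eq_zero_imp_mem hz hb)
  rw [hm] at hle ⊢
  rw [hd] at hge
  have h1 : m ≤ n := by exact_mod_cast hle
  have h2 : n + 1 ≤ m + 1 := by exact_mod_cast hge
  obtain rfl : m = n := by omega
  norm_cast

end IsRegularNormalQuotient

/-! ### The concrete quotient, opposite rings and the conclusion -/

/-- Normality makes the right ideal zB closed under left multiplication. -/
theorem mem_span_singleton_iff_of_isNormalElement {B : Type*} [Ring B] {z : B}
    (hz : IsNormalElement z) {b : B} : b ∈ TwoSidedIdeal.span {z} ↔ ∃ c, z * c = b := by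
  constructor
  · intro hb
    let I : TwoSidedIdeal B := TwoSidedIdeal.mk' (Set.range fun c => z * c)
      ⟨0, mul_zero z⟩
      (by rintro _ _ ⟨x, rfl⟩ ⟨y, rfl⟩; exact ⟨x + y, mul_add z x y⟩)
      (by rintro _ ⟨x, rfl⟩; exact ⟨-x, mul_neg z x⟩)
      (by
        rintro a _ ⟨y, rfl⟩
        obtain ⟨c, hc⟩ : a * z ∈ Set.range fun b : B => z * b := hz ▸ ⟨a, rfl⟩
        exact ⟨c * y, by dsimp only at hc ⊢; rw [← mul_assoc, hc, mul_assoc]⟩)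
      (by rintro _ a ⟨x, rfl⟩; exact ⟨x * a, (mul_assoc z x a).symm⟩)
    have hI : ∀ x, x ∈ I ↔ x ∈ Set.range fun c => z * c := fun x => TwoSidedIdeal.mem_mk' ..
    refine (hI b).1 (TwoSidedIdeal.mem_span_iff.1 hb I ?_)
    rintro _ rfl
    exact (hI _).2 ⟨1, mul_one _⟩
  · rintro ⟨c, rfl⟩
    exact TwoSidedIdeal.mul_mem_right _ _ _ (TwoSidedIdeal.subset_span rfl)

theorem isRegularNormalQuotient_mk {B : Type*} [Ring B] {z : B} (hreg : IsRegular z)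
    (hz : IsNormalElement z) :
    IsRegularNormalQuotient (Ideal.Quotient.mk (TwoSidedIdeal.span {z}).asIdeal) z where
  surjective := Ideal.Quotient.mk_surjective
  isRegular := hreg
  map_eq_zero_iff_left b := by
    rw [Ideal.Quotient.eq_zero_iff_mem, TwoSidedIdeal.mem_asIdeal,
      mem_span_singleton_iff_of_isNormalElement hz]
  map_eq_zero_iff_right b := by
    rw [Ideal.Quotient.eq_zero_iff_mem, TwoSidedIdeal.mem_asIdeal,
      mem_span_singleton_iff_of_isNormalElement hz]
    exact Set.ext_iff.1 hz b

theorem IsRegularNormalQuotient.op {A B : Type*} [Ring A] [Ring B] {f : B →+* A} {z : B}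
    (hf : IsRegularNormalQuotient f z) :
    IsRegularNormalQuotient (RingHom.op f) (MulOpposite.op z) where
  surjective a := by
    obtain ⟨b, hb⟩ := hf.surjective a.unop
    exact ⟨MulOpposite.op b, congrArg MulOpposite.op hb⟩
  isRegular := ⟨fun a b hab => MulOpposite.unop_injective
      (hf.isRegular.right (congrArg MulOpposite.unop hab)),
    fun a b hab => MulOpposite.unop_injective
      (hf.isRegular.left (congrArg MulOpposite.unop hab))⟩
  map_eq_zero_iff_left b := by
    refine Iff.trans (MulOpposite.op_eq_zero_iff (f b.unop))
      ((hf.map_eq_zero_iff_right b.unop).trans ⟨?_, ?_⟩)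
    · rintro ⟨c, hc⟩
      exact ⟨MulOpposite.op c, congrArg MulOpposite.op hc⟩
    · rintro ⟨c, hc⟩
      exact ⟨c.unop, congrArg MulOpposite.unop hc⟩
  map_eq_zero_iff_right b := by
    refine Iff.trans (MulOpposite.op_eq_zero_iff (f b.unop))
      ((hf.map_eq_zero_iff_left b.unop).trans ⟨?_, ?_⟩)
    · rintro ⟨c, hc⟩
      exact ⟨MulOpposite.op c, congrArg MulOpposite.op hc⟩
    · rintro ⟨c, hc⟩
      exact ⟨c.unop, congrArg MulOpposite.unop hc⟩

/-- The opposite of a connected graded algebra is connected graded. -/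
theorem IsConnectedGraded.exists_op {k B : Type*} [Field k] [Ring B] [Algebra k B]
    {𝒜 : ℕ → Submodule k B} [GradedAlgebra 𝒜] (hB : IsConnectedGraded 𝒜) :
    ∃ (𝒜' : ℕ → Submodule k Bᵐᵒᵖ) (_ : GradedAlgebra 𝒜'), IsConnectedGraded 𝒜' ∧
      ∀ n, ∀ b ∈ 𝒜 n, MulOpposite.op b ∈ 𝒜' n := by
  classical
  let l : B →ₗ[k] Bᵐᵒᵖ := (MulOpposite.opLinearEquiv k).toLinearMap
  let 𝒜' : ℕ → Submodule k Bᵐᵒᵖ := fun n => (𝒜 n).map l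
  have hint : DirectSum.IsInternal 𝒜' :=
    DirectSum.isInternal_map_of_surjective l (MulOpposite.opLinearEquiv k).surjective
      fun b hb i => by
        obtain rfl : b = 0 := (MulOpposite.opLinearEquiv k).injective (hb.trans (map_zero l).symm)
        rw [DirectSum.decompose_zero]
        exact map_zero l
  have hmonoid : SetLike.GradedMonoid 𝒜' :=
    { one_mem := ⟨1, SetLike.GradedOne.one_mem, rfl⟩
      mul_mem := by
        rintro i j _ _ ⟨a, ha, rfl⟩ ⟨b, hb, rfl⟩
        exact ⟨b * a, add_comm j i ▸ SetLike.mul_mem_graded hb ha, rfl⟩ }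
  let hgraded : GradedAlgebra 𝒜' :=
    { hmonoid, hint.chooseDecomposition with }
  refine ⟨𝒜', hgraded, ⟨?_, ?_⟩, fun n b hb => ⟨b, hb, rfl⟩⟩
  · exact MulOpposite.op_injective.comp hB.algebraMap_injective
  · intro b
    constructor
    · rintro ⟨b, hb, rfl⟩
      obtain ⟨c, rfl⟩ := (hB.mem_zero_iff b).1 hb
      exact ⟨c, rfl⟩
    · rintro ⟨c, rfl⟩
      exact ⟨algebraMap k B c, (hB.mem_zero_iff _).2 ⟨c, rfl⟩, rfl⟩

/-- Let `B` be a connected graded algebra over a field and `z ∈ B_1` a regular (not a zero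
divisor on either side) normal element. If `B` has finite global dimension `d`, then `B/(z)` has
global dimension `d - 1`. This is asserted for the left and for the right global dimension. The
equation `g + 1 = d` in `WithBot ℕ∞` says that `g` is finite, `1 ≤ d` and `g = d - 1`. -/
theorem lemma1p1 {k : Type*} {B : Type u} [Field k] [Ring B] [Algebra k B]
    (𝒜 : ℕ → Submodule k B) [GradedAlgebra 𝒜] (hB : IsConnectedGraded 𝒜)
    (z : B) (hz : z ∈ 𝒜 1) (hreg : IsRegular z) (hnormal : IsNormalElement z) (d : ℕ) :
    (leftGlobalDimension B = d → leftGlobalDimension (QuotientByElement z) + 1 = d) ∧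
    (rightGlobalDimension B = d → rightGlobalDimension (QuotientByElement z) + 1 = d) := by
  have hf := isRegularNormalQuotient_mk hreg hnormal
  refine ⟨fun hd => hf.leftGlobalDimension_add_one hB hz hd, fun hd => ?_⟩
  obtain ⟨𝒜', _, hB', hmem⟩ := hB.exists_op
  -- Working with a surjection `f` instead of a literal quotient pays off here: the opposite of
  -- B/(z) need not be identified with a quotient of `Bᵐᵒᵖ`.
  exact hf.op.leftGlobalDimension_add_one hB' (hmem 1 z hz) hd
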